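/- Fix an integer $k\ge 1$ and $c\in(0,\infty)$, and let $m=m(n)$ be integers with $m\to\infty$ and $m/n^k\to c$ as $n\to\infty$. For every $m$ let $\tau_1,\dots,\tau_m$ be real numbers (which may depend on $m$), and suppose that their normalized counting measures $\sigma_m(\Delta)=\frac1m\,\mathrm{Card}\{\alpha\le m:\tau_\alpha\in\Delta\}$ converge weakly, as $m\to\infty$, to a measure $\sigma$ on $\mathbb R$ with $\sigma(\mathbb R)=1$. For every $n$ let $\mathbf y=\mathbf y_n=(y_1,\dots,y_n)$ be a random vector in $\mathbb R^n$ with $\mathbf E\{y_j\}=0$ and $\mathbf E\{y_iy_j\}=\delta_{ij}n^{-1}$, $1\le i,j\le n$ (a normalized isotropic vector), which is good: there are $\delta_n\to0$ such that, for every $n$ and every complex $n\times n$ matrix $H$, $$\mathbf{Var}\{(H\mathbf y,\mathbf y)\}=\mathbf E\big\{|(H\mathbf y,\mathbf y)-\mathbf E\{(H\mathbf y,\mathbf y)\}|^2\big\}\le \|H\|^2\delta_n ,$$ where $\|H\|$ is the Euclidean operator norm. Let $\mathbf y_\alpha^{(j)}$, $1\le\alpha\le m$, $1\le j\le k$, be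 i.i.d. copies of $\mathbf y$, let $Y_\alpha=\mathbf y_\alpha^{(1)}\otimes\cdots\otimes\mathbf y_\alpha^{(k)}\in(\mathbb R^n)^{\otimes k}$, and consider the $n^k\times n^k$ real symmetric random matrix $$\mathcal M_{n,m,k}=\sum_{\alpha=1}^m\tau_\alpha Y_\alpha Y_\alpha^T .$$ Let $N_n$ be the normalized counting measure of its eigenvalues $\lambda_1,\dots,\lambda_{n^k}$ (counted with multiplicity), $N_n(\Delta)=n^{-k}\,\mathrm{Card}\{l:\lambda_l\in\Delta\}$. Then there is a non-random measure $N$ on $\mathbb R$ of total mass $1$ such that $N_n$ converges weakly in probability to $N$ as $n\to\infty$, that is, $\int\varphi\,dN_n\to\int\varphi\,dN$ in probability for every bounded continuous $\varphi:\mathbb R\to\mathbb R$. The Stieltjes transform $f(z)=\int\frac{N(d\lambda)}{\lambda-z}$, $\Im z\ne0$, of $N$ is the unique solution of the functional equation $$zf(z)=c-1-c\int(1+\tau f(z))^{-1}\sigma(d\tau),\qquad \Im z\neq 0,$$ in the class of functions analytic in $\mathbb C\setminus\mathbb R$ with $\Im f(z)\,\Im z\ge0$ for $\Im z\ne0$.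 -/

import Mathlib

open MeasureTheory ProbabilityTheory Filter Topology
open scoped NNReal ENNReal BoundedContinuousFunction

noncomputable section

/-- The normalized counting measure of a finite family of reals:
each member of the family carries mass `1 / card ι` (counted with multiplicity). -/
def normalizedCountingMeasure {ι : Type*} [Fintype ι] (x : ι → ℝ) : FiniteMeasure ℝ :=
  ((Fintype.card ι : ℝ≥0)⁻¹) • ∑ i, (diracProba (x i)).toFiniteMeasure

/-- `ν`, the law of a random vector of `ℝⁿ`, is normalized isotropic:
`E y_j = 0` and `E y_i y_j = δ_{ij} / n` (square integrability of the components is explicit). -/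
structure IsNormalizedIsotropic {n : ℕ} (ν : Measure (Fin n → ℝ)) : Prop where
  memLp : ∀ j, MemLp (fun y : Fin n → ℝ => y j) 2 ν
  mean : ∀ j, ∫ y, y j ∂ν = 0
  cov : ∀ i j, ∫ y, y i * y j ∂ν = if i = j then (n : ℝ)⁻¹ else 0

/-- The quadratic form `(H y, y)` of a complex matrix at a real vector. -/
def quadForm {n : ℕ} (H : Matrix (Fin n) (Fin n) ℂ) (y : Fin n → ℝ) : ℂ :=
  ∑ i, ∑ j, H i j * (y j : ℂ) * (y i : ℂ)

/-- Good sequence of normalized isotropic vectors (`ν n` is the law of the vector in `ℝⁿ`):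
`Var (H y, y) ≤ ‖H‖² δ_n` for all complex `n × n` matrices `H`, with `δ_n → 0` not depending on `H`.
Here `‖H‖` is the Euclidean operator norm and `Var ξ = E |ξ - E ξ|²`, which is required to
be finite. -/
structure IsGoodVector (ν : ∀ n : ℕ, Measure (Fin n → ℝ)) : Prop where
  isotropic : ∀ n, IsNormalizedIsotropic (ν n)
  variance_le : ∃ δ : ℕ → ℝ, Tendsto δ atTop (𝓝 0) ∧
    ∀ (n : ℕ) (H : Matrix (Fin n) (Fin n) ℂ),
      MemLp (quadForm H) 2 (ν n) ∧
      ∫ y, ‖quadForm H y - ∫ y', quadForm H y' ∂(ν n)‖ ^ 2 ∂(ν n)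
        ≤ ‖Matrix.toEuclideanCLM (n := Fin n) (𝕜 := ℂ) H‖ ^ 2 * δ n

/-- The tensor product `y⁽¹⁾ ⊗ ⋯ ⊗ y⁽ᵏ⁾` of vectors of `ℝⁿ`, in coordinates:
its component at the multi-index `(j₁, …, j_k)` is `∏ i, y⁽ⁱ⁾_{j_i}`. -/
def tensorVector {n k : ℕ} (y : Fin k → Fin n → ℝ) : (Fin k → Fin n) → ℝ :=
  fun j => ∏ i, y i (j i)

/-- The `nᵏ × nᵏ` matrix `∑ α, τ_α Y_α Y_αᵀ`, where `Y_α = y_α⁽¹⁾ ⊗ ⋯ ⊗ y_α⁽ᵏ⁾`. -/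
def tensorCovMatrix {n m k : ℕ} (τ : Fin m → ℝ) (y : Fin m → Fin k → Fin n → ℝ) :
    Matrix (Fin k → Fin n) (Fin k → Fin n) ℝ :=
  ∑ α, τ α • Matrix.vecMulVec (tensorVector (y α)) (tensorVector (y α))

theorem tensorCovMatrix_isHermitian {n m k : ℕ} (τ : Fin m → ℝ)
    (y : Fin m → Fin k → Fin n → ℝ) : (tensorCovMatrix τ y).IsHermitian := by
  ext i j
  simp [tensorCovMatrix, Matrix.sum_apply, Matrix.vecMulVec_apply, mul_comm]

/-- The normalized counting measure of the eigenvalues (with multiplicity) of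
`tensorCovMatrix τ y`. -/
def eigenvalueNCM {n m k : ℕ} (τ : Fin m → ℝ) (y : Fin m → Fin k → Fin n → ℝ) :
    FiniteMeasure ℝ :=
  normalizedCountingMeasure (tensorCovMatrix_isHermitian τ y).eigenvalues

/-- Weak convergence in probability of random measures `𝒩 n`, each defined on its own probability
space `(Ω n, P n)`, to a non-random measure `N`: for every bounded continuous `φ`,
`∫ φ d𝒩 n → ∫ φ dN` in probability. -/
def TendstoWeaklyInProbability {Ω : ℕ → Type*} [∀ n, MeasurableSpace (Ω n)]
    (P : ∀ n, Measure (Ω n)) (𝒩 : ∀ n, Ω n → FiniteMeasure ℝ) (N : ProbabilityMeasure ℝ) : Prop :=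
  ∀ (φ : ℝ →ᵇ ℝ) (ε : ℝ), 0 < ε →
    Tendsto (fun n => P n {ω | ε ≤ |(∫ x, φ x ∂(𝒩 n ω : Measure ℝ)) - ∫ x, φ x ∂(N : Measure ℝ)|})
      atTop (𝓝 0)

/-- The Stieltjes transform `z ↦ ∫ N(dλ) / (λ - z)` (used for `Im z ≠ 0`). -/
def stieltjesTransform (N : ProbabilityMeasure ℝ) (z : ℂ) : ℂ :=
  resolventTransform (N : Measure ℝ) z

theorem stieltjesTransform_eq (N : ProbabilityMeasure ℝ) (z : ℂ) :
    stieltjesTransform N z = ∫ x : ℝ, ((x : ℂ) - z)⁻¹ ∂(N : Measure ℝ) := by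
  simp [stieltjesTransform, resolventTransform_apply, resolvent]

/-- `f` is analytic in `ℂ \ ℝ`, satisfies `Im f(z) Im z ≥ 0` there, and solves
`z f(z) = c - 1 - c ∫ (1 + t f(z))⁻¹ σ(dt)` there. The two middle fields say that the integral
makes sense. Values of `f` on the real line are irrelevant. -/
structure IsMPSolution (c : ℝ) (σ : ProbabilityMeasure ℝ) (f : ℂ → ℂ) : Prop where
  analytic : AnalyticOnNhd ℂ f {z : ℂ | z.im ≠ 0}
  im_mul_im_nonneg : ∀ z : ℂ, z.im ≠ 0 → 0 ≤ (f z).im * z.im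
  ne_zero : ∀ z : ℂ, z.im ≠ 0 → ∀ᵐ t : ℝ ∂(σ : Measure ℝ), 1 + (t : ℂ) * f z ≠ 0
  integrable : ∀ z : ℂ, z.im ≠ 0 →
    Integrable (fun t : ℝ => (1 + (t : ℂ) * f z)⁻¹) (σ : Measure ℝ)
  equation : ∀ z : ℂ, z.im ≠ 0 →
    z * f z = (c : ℂ) - 1 - (c : ℂ) * ∫ t : ℝ, (1 + (t : ℂ) * f z)⁻¹ ∂(σ : Measure ℝ)

end

/-! Why the theorem holds. Write `G` for the resolvent of the matrix at `z` with `Im z > 0` and `g`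
for its normalized trace. Taking the trace of `(M - z) G = 1` gives `1 + z g = n⁻ᵏ ∑ τ_α (G Y_α,
Y_α)`. By the rank-one formula, `τ_α (G Y_α, Y_α) = 1 - (1 + τ_α (G_α Y_α, Y_α))⁻¹`, where `G_α`
omits the `α`-th term and is therefore independent of `Y_α`. The form `(G_α Y_α, Y_α)` concentrates
around the normalized trace of `G_α`, which differs from `g` by at most `(nᵏ Im z)⁻¹`. So `g` nearly
solves the limiting equation (`norm_approx_equation_le`). The equation is written for the random `g`
itself, so no separate concentration of `g` is needed.

Concentration at tensor products (`HasQuadVariance.lintegral_tensor`) goes by induction on `k`. With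
all factors but the first frozen, the form is a quadratic form in one good vector, and its
conditional mean is the form of a partial trace at a `(k-1)`-fold tensor.

No moments of `σ` are assumed. The weights are truncated at a level `T → ∞`; each altered weight is
a rank-one perturbation, moving the trace of the resolvent by at most `(Im z)⁻¹`, and only `o(nᵏ)`
weights are altered.

The limit is taken along chosen sample points. If an event keeps probability at least `ρ > 0`
infinitely often, it contains points, for infinitely many `n`, at which the errors at a countable
dense set of `z` tend to zero (`exists_seq_of_frequently`). Along these points the spectral measures
are tight, and a subsequential limit has a Stieltjes transform solving the equation
(`exists_seq_tendsto_eigenvalueNCM`). The equation has at most one solution with positive imaginary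
part (`mpEquation_unique`), and a Stieltjes transform determines its measure. Applied to the sure
event, this produces `N`; applied to events where `∫ φ dN_n` stays away from `∫ φ dN`, it gives a
contradiction. -/

noncomputable section

/-! ### Resolvents of real symmetric matrices -/

section Resolvent

open Matrix

variable {I : Type*} [Fintype I]

/-- The Euclidean norm of a finite complex vector. -/
def l2norm {I : Type*} [Fintype I] (u : I → ℂ) : ℝ := √(∑ i, ‖u i‖ ^ 2)

lemma l2norm_nonneg (u : I → ℂ) : 0 ≤ l2norm u := Real.sqrt_nonneg _

lemma l2norm_sq (u : I → ℂ) : l2norm u ^ 2 = ∑ i, ‖u i‖ ^ 2 :=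
  Real.sq_sqrt (Finset.sum_nonneg fun _ _ => by positivity)

lemma norm_dotProduct_le (u v : I → ℂ) : ‖u ⬝ᵥ v‖ ≤ l2norm u * l2norm v := by
  unfold dotProduct l2norm
  refine (norm_sum_le _ _).trans ?_
  simp only [norm_mul]
  exact Real.sum_mul_le_sqrt_mul_sqrt _ _ _

lemma l2norm_star (u : I → ℂ) : l2norm (star u) = l2norm u := by
  simp [l2norm]

/-- The bilinear form of `H` is bounded by `h`, i.e. the operator norm of `H` is at most `h`. -/
def BilinBound {I : Type*} [Fintype I] (H : Matrix I I ℂ) (h : ℝ) : Prop :=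
  ∀ u v : I → ℂ, ‖u ⬝ᵥ H *ᵥ v‖ ≤ h * l2norm u * l2norm v

/-- A real vector seen as a complex one. -/
def cvec {I : Type*} (Y : I → ℝ) : I → ℂ := fun i => (Y i : ℂ)

lemma star_cvec {I : Type*} (Y : I → ℝ) : star (cvec Y) = cvec Y := by
  ext i; simp [cvec]

lemma l2norm_cvec_sq (Y : I → ℝ) : l2norm (cvec Y) ^ 2 = ∑ i, Y i ^ 2 := by
  simp [l2norm_sq, cvec]

lemma star_dotProduct_self_eq (v : I → ℂ) : star v ⬝ᵥ v = ((l2norm v ^ 2 : ℝ) : ℂ) := by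
  rw [l2norm_sq, dotProduct, Complex.ofReal_sum]
  refine Finset.sum_congr rfl fun i _ => ?_
  rw [Complex.ofReal_pow]
  exact Complex.conj_mul' (v i)

lemma isHermitian_add_rankOne {I : Type*} {S : Matrix I I ℝ} (hS : S.IsHermitian) (t : ℝ) (Y : I → ℝ) :
    (S + t • vecMulVec Y Y).IsHermitian := by
  refine hS.add ?_
  ext i j
  simp [vecMulVec_apply, mul_comm]

variable [DecidableEq I]

/-- `S - z` for a real matrix `S`. -/
def shifted (S : Matrix I I ℝ) (z : ℂ) : Matrix I I ℂ := S.map (fun x => (x : ℂ)) - z • 1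

/-- The form of a Hermitian matrix is real, so only `-z` contributes. Invertibility of `S - z` and
the bound `(Im z)⁻¹` for its inverse both follow from this identity. -/
lemma im_dotProduct_shifted {S : Matrix I I ℝ} (hS : S.IsHermitian) (z : ℂ) (v : I → ℂ) :
    (star v ⬝ᵥ shifted S z *ᵥ v).im = -(z.im * l2norm v ^ 2) := by
  have hSc : (S.map (fun x => (x : ℂ))).IsHermitian := by
    ext i j
    have := congrFun (congrFun hS i) j
    simpa using this
  have h1 : (star v ⬝ᵥ S.map (fun x => (x : ℂ)) *ᵥ v).im = 0 := by
    have : star (star v ⬝ᵥ S.map (fun x => (x : ℂ)) *ᵥ v)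
        = star v ⬝ᵥ S.map (fun x => (x : ℂ)) *ᵥ v := by
      rw [← star_dotProduct_star, star_mulVec, hSc.eq, ← dotProduct_mulVec, star_star]
    exact Complex.conj_eq_iff_im.1 this
  rw [shifted, sub_mulVec, dotProduct_sub, Complex.sub_im, h1, smul_mulVec, one_mulVec,
    dotProduct_smul, star_dotProduct_self_eq, smul_eq_mul, Complex.im_mul_ofReal]
  ring

lemma isUnit_det_shifted {S : Matrix I I ℝ} (hS : S.IsHermitian) {z : ℂ} (hz : 0 < z.im) :
    IsUnit (shifted S z).det := by
  rw [isUnit_iff_ne_zero]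
  intro h0
  obtain ⟨v, hv, hv0⟩ := exists_mulVec_eq_zero_iff.2 h0
  have h := im_dotProduct_shifted hS z v
  rw [hv0, dotProduct_zero, Complex.zero_im] at h
  have h2 : l2norm v ^ 2 = 0 := by
    rcases mul_eq_zero.1 (neg_eq_zero.1 h.symm) with h | h
    · exact absurd h hz.ne'
    · exact h
  rw [l2norm_sq, Finset.sum_eq_zero_iff_of_nonneg (fun _ _ => by positivity)] at h2
  exact hv (funext fun i => by simpa using h2 i (Finset.mem_univ i))

lemma shifted_mul_inv {S : Matrix I I ℝ} (hS : S.IsHermitian) {z : ℂ} (hz : 0 < z.im) :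
    shifted S z * (shifted S z)⁻¹ = 1 := mul_nonsing_inv _ (isUnit_det_shifted hS hz)

lemma inv_mul_shifted {S : Matrix I I ℝ} (hS : S.IsHermitian) {z : ℂ} (hz : 0 < z.im) :
    (shifted S z)⁻¹ * shifted S z = 1 := nonsing_inv_mul _ (isUnit_det_shifted hS hz)

lemma l2norm_inv_mulVec_sq {S : Matrix I I ℝ} (hS : S.IsHermitian) {z : ℂ} (hz : 0 < z.im)
    (v : I → ℂ) : (star ((shifted S z)⁻¹ *ᵥ v) ⬝ᵥ v).im
      = -(z.im * l2norm ((shifted S z)⁻¹ *ᵥ v) ^ 2) := by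
  rw [← im_dotProduct_shifted hS, mulVec_mulVec, shifted_mul_inv hS hz, one_mulVec]

lemma l2norm_inv_mulVec_le {S : Matrix I I ℝ} (hS : S.IsHermitian) {z : ℂ} (hz : 0 < z.im)
    (v : I → ℂ) : l2norm ((shifted S z)⁻¹ *ᵥ v) ≤ z.im⁻¹ * l2norm v := by
  have h1 := l2norm_inv_mulVec_sq hS hz v
  set w := (shifted S z)⁻¹ *ᵥ v
  have h2 : z.im * l2norm w ^ 2 ≤ l2norm w * l2norm v := by
    calc z.im * l2norm w ^ 2 = |(star w ⬝ᵥ v).im| := by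
          rw [h1, abs_neg, abs_of_nonneg (by positivity)]
      _ ≤ ‖star w ⬝ᵥ v‖ := Complex.abs_im_le_norm _
      _ ≤ _ := (norm_dotProduct_le _ _).trans_eq (by rw [l2norm_star])
  rcases (l2norm_nonneg w).eq_or_lt with h | h
  · rw [← h]; exact mul_nonneg (inv_nonneg.2 hz.le) (l2norm_nonneg _)
  · rw [le_inv_mul_iff₀ hz]
    nlinarith

lemma bilinBound_inv_shifted {S : Matrix I I ℝ} (hS : S.IsHermitian) {z : ℂ} (hz : 0 < z.im) :
    BilinBound (shifted S z)⁻¹ z.im⁻¹ := fun u v => by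
  refine (norm_dotProduct_le _ _).trans ?_
  have := mul_le_mul_of_nonneg_left (l2norm_inv_mulVec_le hS hz v) (l2norm_nonneg u)
  linarith

/-- This makes `|Im (1 + t (H Y, Y))| = |t| Im z ‖H Y‖²`, the lower bound on the rank-one
denominator. -/
lemma im_quad_inv {S : Matrix I I ℝ} (hS : S.IsHermitian) {z : ℂ} (hz : 0 < z.im) (Y : I → ℝ) :
    (cvec Y ⬝ᵥ (shifted S z)⁻¹ *ᵥ cvec Y).im
      = z.im * l2norm ((shifted S z)⁻¹ *ᵥ cvec Y) ^ 2 := by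
  have h1 := l2norm_inv_mulVec_sq hS hz (cvec Y)
  set w := (shifted S z)⁻¹ *ᵥ cvec Y
  have : star (star w ⬝ᵥ cvec Y) = cvec Y ⬝ᵥ w := by
    rw [← star_dotProduct_star, star_cvec, star_star]
  rw [← this, Complex.star_def, Complex.conj_im, h1, neg_neg]

lemma isSymm_shifted {I : Type*} [DecidableEq I] {S : Matrix I I ℝ} (hS : S.IsHermitian) (z : ℂ) :
    (shifted S z)ᵀ = shifted S z := by
  ext i j
  have := congrFun (congrFun hS i) j
  simp only [conjTranspose_apply, star_trivial] at this
  simp [shifted, this, Matrix.one_apply, eq_comm]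

lemma transpose_inv_shifted {S : Matrix I I ℝ} (hS : S.IsHermitian) (z : ℂ) :
    ((shifted S z)⁻¹)ᵀ = (shifted S z)⁻¹ := by
  rw [transpose_nonsing_inv, isSymm_shifted hS]

lemma shifted_add_rankOne {I : Type*} [DecidableEq I] (S : Matrix I I ℝ) (t : ℝ) (Y : I → ℝ) (z : ℂ) :
    shifted (S + t • vecMulVec Y Y) z
      = shifted S z + (t : ℂ) • vecMulVec (cvec Y) (cvec Y) := by
  ext i j
  simp [shifted, vecMulVec_apply, cvec]
  ring

/-- Second resolvent identity. The right factor can be written as `H Y` because `H` is symmetric for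
the transpose without conjugation. -/
lemma inv_rankOne_sub {S : Matrix I I ℝ} (hS : S.IsHermitian) {z : ℂ} (hz : 0 < z.im)
    (t : ℝ) (Y : I → ℝ) :
    (shifted (S + t • vecMulVec Y Y) z)⁻¹ - (shifted S z)⁻¹
      = -((t : ℂ) • vecMulVec ((shifted (S + t • vecMulVec Y Y) z)⁻¹ *ᵥ cvec Y)
          ((shifted S z)⁻¹ *ᵥ cvec Y)) := by
  have hS' := isHermitian_add_rankOne hS t Y
  set G := (shifted (S + t • vecMulVec Y Y) z)⁻¹ with hG
  set H := (shifted S z)⁻¹ with hH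
  have e1 : G * shifted (S + t • vecMulVec Y Y) z = 1 := inv_mul_shifted hS' hz
  have e2 : shifted S z * H = 1 := shifted_mul_inv hS hz
  have hHt : H *ᵥ cvec Y = cvec Y ᵥ* H := by
    conv_lhs => rw [hH, ← transpose_inv_shifted hS z, mulVec_transpose]
  calc G - H = G * (shifted S z * H) - (G * shifted (S + t • vecMulVec Y Y) z) * H := by
        rw [e1, e2, mul_one, one_mul]
    _ = -((t : ℂ) • (G * vecMulVec (cvec Y) (cvec Y) * H)) := by
        rw [shifted_add_rankOne]
        simp only [mul_add, add_mul, Matrix.mul_smul, Matrix.smul_mul, Matrix.mul_assoc]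
        abel
    _ = _ := by
        rw [mul_vecMulVec, vecMulVec_mul, hHt]

lemma inv_rankOne_mulVec {S : Matrix I I ℝ} (hS : S.IsHermitian) {z : ℂ} (hz : 0 < z.im)
    (t : ℝ) (Y : I → ℝ) :
    (1 + (t : ℂ) * (cvec Y ⬝ᵥ (shifted S z)⁻¹ *ᵥ cvec Y)) •
        ((shifted (S + t • vecMulVec Y Y) z)⁻¹ *ᵥ cvec Y)
      = (shifted S z)⁻¹ *ᵥ cvec Y := by
  have h := congrArg (fun M => M *ᵥ cvec Y) (inv_rankOne_sub hS hz t Y)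
  simp only [sub_mulVec, neg_mulVec, smul_mulVec, vecMulVec_mulVec] at h
  rw [sub_eq_iff_eq_add] at h
  rw [dotProduct_comm]
  set G := (shifted (S + t • vecMulVec Y Y) z)⁻¹ *ᵥ cvec Y
  set H := (shifted S z)⁻¹ *ᵥ cvec Y
  ext i
  have := congrFun h i
  simp at this ⊢
  linear_combination this

/-- Sherman–Morrison without division, so the denominator need not be known to be nonzero. -/
lemma mul_quad_rankOne {S : Matrix I I ℝ} (hS : S.IsHermitian) {z : ℂ} (hz : 0 < z.im)
    (t : ℝ) (Y : I → ℝ) :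
    (1 + (t : ℂ) * (cvec Y ⬝ᵥ (shifted S z)⁻¹ *ᵥ cvec Y)) *
        (cvec Y ⬝ᵥ (shifted (S + t • vecMulVec Y Y) z)⁻¹ *ᵥ cvec Y)
      = cvec Y ⬝ᵥ (shifted S z)⁻¹ *ᵥ cvec Y := by
  have h := congrArg (fun v => cvec Y ⬝ᵥ v) (inv_rankOne_mulVec hS hz t Y)
  simpa only [dotProduct_smul, smul_eq_mul] using h

/-- The trace difference is `-t (H Y) ⬝ (H Y) / (1 + t a)` with `a = (H Y, Y)`. The numerator is at
most `|t| ‖H Y‖²` and the denominator at least `|t| Im z ‖H Y‖²`. The bound does not involve `t` or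
`Y`, so arbitrarily large weights can be truncated. -/
lemma norm_trace_inv_rankOne_sub_le {S : Matrix I I ℝ} (hS : S.IsHermitian) {z : ℂ}
    (hz : 0 < z.im) (t : ℝ) (Y : I → ℝ) :
    ‖(shifted (S + t • vecMulVec Y Y) z)⁻¹.trace - (shifted S z)⁻¹.trace‖ ≤ z.im⁻¹ := by
  have h1 := congrArg trace (inv_rankOne_sub hS hz t Y)
  rw [trace_sub, trace_neg, trace_smul, trace_vecMulVec] at h1
  have h2 := inv_rankOne_mulVec hS hz t Y
  have h3 := im_quad_inv hS hz Y
  set G := (shifted (S + t • vecMulVec Y Y) z)⁻¹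
  set H := (shifted S z)⁻¹
  set a := cvec Y ⬝ᵥ H *ᵥ cvec Y
  have h4 : (1 + (t : ℂ) * a) * (G.trace - H.trace)
      = -((t : ℂ) * ((H *ᵥ cvec Y) ⬝ᵥ (H *ᵥ cvec Y))) := by
    conv_rhs => rw [← h2]
    rw [h1, smul_dotProduct, h2]
    simp only [smul_eq_mul]
    ring
  have h5 : |t| * (z.im * l2norm (H *ᵥ cvec Y) ^ 2) ≤ ‖1 + (t : ℂ) * a‖ := by
    calc |t| * (z.im * l2norm (H *ᵥ cvec Y) ^ 2) = |(1 + (t : ℂ) * a).im| := by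
          simp [h3, abs_mul, abs_of_pos hz]
      _ ≤ _ := Complex.abs_im_le_norm _
  have h6 : ‖1 + (t : ℂ) * a‖ * ‖G.trace - H.trace‖ ≤ |t| * l2norm (H *ᵥ cvec Y) ^ 2 := by
    rw [← norm_mul, h4, norm_neg, norm_mul, Complex.norm_real, Real.norm_eq_abs, sq]
    exact mul_le_mul_of_nonneg_left (norm_dotProduct_le _ _) (abs_nonneg _)
  -- If `1 + t a` vanished, `h2` would give `H Y = 0`, hence `a = 0` and `1 = 0`.
  have hpos : 0 < ‖1 + (t : ℂ) * a‖ := by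
    rw [norm_pos_iff]
    intro h0
    rw [h0, zero_smul] at h2
    rw [show a = cvec Y ⬝ᵥ H *ᵥ cvec Y from rfl, ← h2] at h0
    simp at h0
  refine le_of_mul_le_mul_left (h6.trans ?_) hpos
  rw [← div_eq_mul_inv, le_div_iff₀ hz]
  linarith

end Resolvent
end

noncomputable section

/-! ### Weighted Gram matrices and the approximate functional equation -/

section Gram

open Matrix

/-- The real symmetric matrix `∑ α, τ α • Y α (Y α)ᵀ`. -/
def weightedGram {I A : Type*} [Fintype A] (τ : A → ℝ) (Y : A → I → ℝ) : Matrix I I ℝ :=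
  ∑ α, τ α • vecMulVec (Y α) (Y α)

lemma weightedGram_isHermitian {I A : Type*} [Fintype A] (τ : A → ℝ) (Y : A → I → ℝ) :
    (weightedGram τ Y).IsHermitian := by
  ext i j
  simp [weightedGram, Matrix.sum_apply, vecMulVec_apply, mul_comm]

lemma weightedGram_update {I A : Type*} [Fintype A] [DecidableEq A] (τ : A → ℝ) (Y : A → I → ℝ)
    (α : A) (t : ℝ) :
    weightedGram τ Y
      = weightedGram (Function.update τ α t) Y + (τ α - t) • vecMulVec (Y α) (Y α) := by
  simp only [weightedGram]
  rw [← Finset.add_sum_erase _ _ (Finset.mem_univ α),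
    ← Finset.add_sum_erase _ (fun β => Function.update τ α t β • _) (Finset.mem_univ α),
    Finset.sum_congr rfl fun β hβ => by
      rw [← Function.update_of_ne (Finset.ne_of_mem_erase hβ) t τ]]
  simp only [Function.update_self, sub_smul]
  abel

/-- This is the independence behind the argument: the matrix without the term `α` does not see the
vector `Y α`. -/
lemma weightedGram_update_zero_update {I A : Type*} [Fintype A] [DecidableEq A] (τ : A → ℝ)
    (Y : A → I → ℝ) (α : A) (y : I → ℝ) :
    weightedGram (Function.update τ α 0) (Function.update Y α y)
      = weightedGram (Function.update τ α 0) Y := by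
  refine Finset.sum_congr rfl fun β _ => ?_
  by_cases h : β = α
  · subst h; simp
  · simp [h]

variable {I A : Type*} [Fintype I] [DecidableEq I] [Fintype A]

/-- The resolvent of the weighted Gram matrix. -/
def gramResolvent (τ : A → ℝ) (Y : A → I → ℝ) (z : ℂ) : Matrix I I ℂ :=
  (shifted (weightedGram τ Y) z)⁻¹

/-- The normalized trace of the resolvent of the weighted Gram matrix. -/
def gramTrace (τ : A → ℝ) (Y : A → I → ℝ) (z : ℂ) : ℂ :=
  (gramResolvent τ Y z).trace / Fintype.card I

/-- The altered weights are changed one at a time, each at cost `(Im z)⁻¹`. -/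
lemma norm_trace_gramResolvent_sub_le [DecidableEq A] (τ τ' : A → ℝ) (Y : A → I → ℝ) {z : ℂ}
    (hz : 0 < z.im) :
    ‖(gramResolvent τ Y z).trace - (gramResolvent τ' Y z).trace‖
      ≤ (Finset.univ.filter fun α => τ α ≠ τ' α).card * z.im⁻¹ := by
  suffices H : ∀ s : Finset A, ∀ τ : A → ℝ, (∀ α, α ∉ s → τ α = τ' α) →
      ‖(gramResolvent τ Y z).trace - (gramResolvent τ' Y z).trace‖ ≤ s.card * z.im⁻¹ from
    H _ τ fun α hα => by simpa using hα
  intro s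
  induction s using Finset.induction_on with
  | empty =>
    intro τ h
    rw [funext fun α => h α (Finset.notMem_empty α)]
    simp
  | insert a s ha ih =>
    intro τ h
    have h1 := ih (Function.update τ a (τ' a)) fun α hα => by
      by_cases hαa : α = a
      · subst hαa; simp
      · rw [Function.update_of_ne hαa]
        exact h α (by simp [hαa, hα])
    have h2 := norm_trace_inv_rankOne_sub_le
      (weightedGram_isHermitian (Function.update τ a (τ' a)) Y) hz (τ a - τ' a) (Y a)
    rw [← weightedGram_update] at h2
    rw [Finset.card_insert_of_notMem ha]
    refine (norm_sub_le_norm_sub_add_norm_sub _ _ _).trans ((add_le_add h2 h1).trans_eq ?_)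
    push_cast; ring

/-- Normalized trace of `(S - z) G = 1`, with `S` expanded into its rank-one terms. -/
lemma one_add_mul_gramTrace [Nonempty I] (τ : A → ℝ) (Y : A → I → ℝ) {z : ℂ} (hz : 0 < z.im) :
    1 + z * gramTrace τ Y z = (Fintype.card I : ℂ)⁻¹ *
      ∑ α, (τ α : ℂ) * (cvec (Y α) ⬝ᵥ gramResolvent τ Y z *ᵥ cvec (Y α)) := by
  have h := congrArg trace (shifted_mul_inv (weightedGram_isHermitian τ Y) hz)
  have e : shifted (weightedGram τ Y) z
      = (∑ α, (τ α : ℂ) • vecMulVec (cvec (Y α)) (cvec (Y α))) - z • 1 := by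
    ext i j
    simp [shifted, weightedGram, Matrix.sum_apply, vecMulVec_apply, cvec]
  have hG : (shifted (weightedGram τ Y) z)⁻¹ = gramResolvent τ Y z := rfl
  rw [hG, e, sub_mul, trace_sub, Matrix.smul_mul, one_mul, trace_smul, trace_one, Finset.sum_mul,
    trace_sum, sub_eq_iff_eq_add] at h
  have hN : (Fintype.card I : ℂ) ≠ 0 := by simp
  have h2 : ∀ α, (((τ α : ℂ) • vecMulVec (cvec (Y α)) (cvec (Y α))) * gramResolvent τ Y z).trace
      = (τ α : ℂ) * (cvec (Y α) ⬝ᵥ gramResolvent τ Y z *ᵥ cvec (Y α)) := fun α => by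
    rw [Matrix.smul_mul, trace_smul, vecMulVec_mul, trace_vecMulVec, smul_eq_mul,
      dotProduct_comm, dotProduct_mulVec]
  rw [Finset.sum_congr rfl fun α _ => h2 α] at h
  rw [h, gramTrace, smul_eq_mul]
  field_simp

/-- The resolvent of the weighted Gram matrix with the term `α` removed. -/
def minorResolvent [DecidableEq A] (τ : A → ℝ) (Y : A → I → ℝ) (z : ℂ) (α : A) : Matrix I I ℂ :=
  gramResolvent (Function.update τ α 0) Y z

/-- The squared deviation of the quadratic form of the resolvent without the term `α` at `Y α`
from the normalized trace. -/
def quadDeviation [DecidableEq A] (τ : A → ℝ) (Y : A → I → ℝ) (z : ℂ) (α : A) : ℝ :=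
  ‖cvec (Y α) ⬝ᵥ minorResolvent τ Y z α *ᵥ cvec (Y α)
    - (minorResolvent τ Y z α).trace / Fintype.card I‖ ^ 2

lemma gramResolvent_eq_update [DecidableEq A] (τ : A → ℝ) (Y : A → I → ℝ) (z : ℂ) (α : A) :
    gramResolvent τ Y z = (shifted (weightedGram (Function.update τ α 0) Y
      + τ α • vecMulVec (Y α) (Y α)) z)⁻¹ := by
  rw [gramResolvent, weightedGram_update τ Y α 0, sub_zero]

lemma norm_quad_gramResolvent_le (τ : A → ℝ) (Y : A → I → ℝ) {z : ℂ} (hz : 0 < z.im) (v : I → ℝ) :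
    ‖cvec v ⬝ᵥ gramResolvent τ Y z *ᵥ cvec v‖ ≤ z.im⁻¹ * ∑ i, v i ^ 2 := by
  refine (bilinBound_inv_shifted (weightedGram_isHermitian τ Y) hz _ _).trans_eq ?_
  rw [mul_assoc, ← sq, l2norm_cvec_sq]

/-- Multiplying `1 + t w` by the conjugate of `w` turns the `t`-term into the real number `t |w|²`,
so the imaginary part is free of `t`. The uniformity in `t` is what makes unbounded weights
harmless. -/
lemma im_div_norm_le_norm_one_add (t : ℝ) {w : ℂ} (hw : 0 < w.im) :
    w.im / ‖w‖ ≤ ‖1 + (t : ℂ) * w‖ := by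
  have hw0 : 0 < ‖w‖ := by
    rw [norm_pos_iff]; rintro rfl; simp at hw
  rw [div_le_iff₀ hw0]
  calc w.im = |((1 + (t : ℂ) * w) * (starRingEnd ℂ w)).im| := by
        rw [add_mul, one_mul, mul_assoc, Complex.mul_conj, ← Complex.ofReal_mul]
        simp [abs_of_pos hw]
    _ ≤ _ := Complex.abs_im_le_norm _
    _ = _ := by rw [norm_mul, Complex.norm_conj]

lemma one_add_ofReal_mul_ne_zero (t : ℝ) {w : ℂ} (hw : 0 < w.im) : 1 + (t : ℂ) * w ≠ 0 := by
  intro h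
  have h1 := im_div_norm_le_norm_one_add t hw
  rw [h, norm_zero] at h1
  have hw0 : 0 < ‖w‖ := by
    rw [norm_pos_iff]; rintro rfl; simp at hw
  exact absurd (div_pos hw hw0) (not_lt.2 h1)

lemma norm_inv_one_add_le (t : ℝ) {w : ℂ} (hw : 0 < w.im) :
    ‖(1 + (t : ℂ) * w)⁻¹‖ ≤ ‖w‖ / w.im := by
  rw [norm_inv, ← inv_div]
  refine inv_anti₀ (div_pos hw ?_) (im_div_norm_le_norm_one_add t hw)
  rw [norm_pos_iff]; rintro rfl; simp at hw

lemma norm_gramTrace_sub_minor_le [DecidableEq A] [Nonempty I] (τ : A → ℝ) (Y : A → I → ℝ) {z : ℂ}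
    (hz : 0 < z.im) (α : A) :
    ‖(minorResolvent τ Y z α).trace / Fintype.card I - gramTrace τ Y z‖
      ≤ z.im⁻¹ / Fintype.card I := by
  have h := norm_trace_inv_rankOne_sub_le
    (weightedGram_isHermitian (Function.update τ α 0) Y) hz (τ α) (Y α)
  rw [← gramResolvent_eq_update] at h
  rw [gramTrace, ← sub_div, norm_div, Complex.norm_natCast, norm_sub_rev]
  gcongr
  exact h

/-- With `a` the form of the reduced resolvent and `b` that of the full one, `(1 + τ a) b = a`. The
error is proportional to `a - g`, which passes through the trace of the reduced resolvent. -/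
lemma norm_term_sub_le [DecidableEq A] [Nonempty I] (τ : A → ℝ) (Y : A → I → ℝ) {z : ℂ}
    (hz : 0 < z.im) (hg : 0 < (gramTrace τ Y z).im) {T s : ℝ} (hs : 0 < s) (α : A)
    (hτ : |τ α| ≤ T) :
    ‖(τ α : ℂ) * (cvec (Y α) ⬝ᵥ gramResolvent τ Y z *ᵥ cvec (Y α))
        - (1 - (1 + (τ α : ℂ) * gramTrace τ Y z)⁻¹)‖
      ≤ ‖gramTrace τ Y z‖ / (gramTrace τ Y z).im *
        (T * (s⁻¹ * (quadDeviation τ Y z α + (z.im⁻¹ / Fintype.card I) ^ 2)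
          + s * (1 + (T * z.im⁻¹ * ∑ i, Y α i ^ 2) ^ 2))) := by
  have h1 := mul_quad_rankOne (weightedGram_isHermitian (Function.update τ α 0) Y) hz (τ α) (Y α)
  rw [← gramResolvent_eq_update] at h1
  have h2 := norm_gramTrace_sub_minor_le τ Y hz α
  have h3 := norm_quad_gramResolvent_le τ Y hz (Y α)
  have h4 := norm_inv_one_add_le (τ α) hg
  have h5 := one_add_ofReal_mul_ne_zero (τ α) hg
  have hT : 0 ≤ T := (abs_nonneg _).trans hτ
  unfold quadDeviation
  rw [show minorResolvent τ Y z α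
    = (shifted (weightedGram (Function.update τ α 0) Y) z)⁻¹ from rfl] at *
  set g := gramTrace τ Y z
  set b := cvec (Y α) ⬝ᵥ gramResolvent τ Y z *ᵥ cvec (Y α)
  set H := (shifted (weightedGram (Function.update τ α 0) Y) z)⁻¹
  set a := cvec (Y α) ⬝ᵥ H *ᵥ cvec (Y α)
  set q := H.trace / Fintype.card I
  set S := ∑ i, Y α i ^ 2
  set N : ℝ := (Fintype.card I : ℝ)
  have hS : 0 ≤ S := Finset.sum_nonneg fun _ _ => sq_nonneg _
  -- The factor `1 - τ b` equals `(1 + τ a)⁻¹`, but in this form it is bounded through `‖Y‖²` with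
  -- no lower bound on the denominator.
  have e : (τ α : ℂ) * b - (1 - (1 + (τ α : ℂ) * g)⁻¹)
      = (1 + (τ α : ℂ) * g)⁻¹ * ((τ α : ℂ) * ((a - g) * (1 - τ α * b))) := by
    field_simp
    linear_combination (τ α : ℂ) * h1
  rw [e, norm_mul]
  have hτ' : ‖(τ α : ℂ)‖ ≤ T := by rwa [Complex.norm_real]
  have hag : ‖a - g‖ ≤ ‖a - q‖ + z.im⁻¹ / N := (norm_sub_le_norm_sub_add_norm_sub _ q _).trans
    (by gcongr)
  have hb : ‖1 - τ α * b‖ ≤ 1 + T * z.im⁻¹ * S := by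
    refine (norm_sub_le _ _).trans ?_
    rw [norm_one, norm_mul, mul_assoc]
    gcongr
  have hN : 0 ≤ z.im⁻¹ / N := by positivity
  have hc : 0 ≤ T * z.im⁻¹ * S := by positivity
  -- Weighted AM–GM: the product becomes a sum of squares, so second moments suffice. The weight `s`
  -- is chosen later to balance the small deviation against the bounded factor.
  have key : (‖a - q‖ + z.im⁻¹ / N) * (1 + T * z.im⁻¹ * S)
      ≤ s⁻¹ * (‖a - q‖ ^ 2 + (z.im⁻¹ / N) ^ 2) + s * (1 + (T * z.im⁻¹ * S) ^ 2) := by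
    generalize ‖a - q‖ = x at *
    generalize z.im⁻¹ / N = y at *
    generalize T * z.im⁻¹ * S = c at *
    have hs' : 0 < s⁻¹ := inv_pos.2 hs
    have hss : s⁻¹ * s = 1 := inv_mul_cancel₀ hs.ne'
    have e1 : (x + y) * (1 + c) ≤ (s⁻¹ * (x + y) ^ 2 + s * (1 + c) ^ 2) / 2 := by
      have : 0 ≤ s⁻¹ * ((x + y) - s * (1 + c)) ^ 2 := by positivity
      have e2 : s⁻¹ * ((x + y) - s * (1 + c)) ^ 2
        = s⁻¹ * (x + y) ^ 2 - 2 * (s⁻¹ * s) * ((x + y) * (1 + c)) + (s⁻¹ * s) * s * (1 + c) ^ 2 := by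
          ring
      rw [hss] at e2
      linarith
    have e3 : s⁻¹ * (x + y) ^ 2 ≤ s⁻¹ * (2 * (x ^ 2 + y ^ 2)) := by
      gcongr; nlinarith [sq_nonneg (x - y)]
    have e4 : s * (1 + c) ^ 2 ≤ s * (2 * (1 + c ^ 2)) := by
      gcongr; nlinarith [sq_nonneg (1 - c)]
    linarith
  refine mul_le_mul h4 ?_ (norm_nonneg _) (by positivity)
  rw [norm_mul]
  refine mul_le_mul hτ' ?_ (norm_nonneg _) hT
  rw [norm_mul]
  exact (mul_le_mul hag hb (norm_nonneg _) (by positivity)).trans key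

/-- The approximate functional equation for the normalized trace of the resolvent. -/
lemma norm_approx_equation_le [DecidableEq A] [Nonempty I] (τ : A → ℝ) (Y : A → I → ℝ) {z : ℂ}
    (hz : 0 < z.im) (hg : 0 < (gramTrace τ Y z).im) {T s : ℝ} (hs : 0 < s)
    (hτ : ∀ α, |τ α| ≤ T) :
    ‖1 + z * gramTrace τ Y z
        - (Fintype.card I : ℂ)⁻¹ * ∑ α, (1 - (1 + (τ α : ℂ) * gramTrace τ Y z)⁻¹)‖
      ≤ ‖gramTrace τ Y z‖ / (gramTrace τ Y z).im * ((Fintype.card I : ℝ)⁻¹ *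
        ∑ α, T * (s⁻¹ * (quadDeviation τ Y z α + (z.im⁻¹ / Fintype.card I) ^ 2)
          + s * (1 + (T * z.im⁻¹ * ∑ i, Y α i ^ 2) ^ 2))) := by
  rw [one_add_mul_gramTrace τ Y hz, ← mul_sub, ← Finset.sum_sub_distrib, norm_mul, norm_inv,
    Complex.norm_natCast, mul_left_comm]
  gcongr
  rw [Finset.mul_sum]
  exact (norm_sum_le _ _).trans
    (Finset.sum_le_sum fun α _ => norm_term_sub_le τ Y hz hg hs α (hτ α))

/-- Taken at `z = i r`, this is the tail bound behind tightness. -/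
lemma norm_one_add_mul_gramTrace_le [Nonempty I] (τ : A → ℝ) (Y : A → I → ℝ) {z : ℂ}
    (hz : 0 < z.im) {T : ℝ} (hτ : ∀ α, |τ α| ≤ T) :
    ‖1 + z * gramTrace τ Y z‖
      ≤ T * z.im⁻¹ * ((Fintype.card I : ℝ)⁻¹ * ∑ α, ∑ i, Y α i ^ 2) := by
  rw [one_add_mul_gramTrace τ Y hz, norm_mul, norm_inv, Complex.norm_natCast, mul_left_comm]
  gcongr
  rw [Finset.mul_sum]
  refine (norm_sum_le _ _).trans (Finset.sum_le_sum fun α _ => ?_)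
  rw [norm_mul, Complex.norm_real, mul_assoc]
  exact mul_le_mul (hτ α) (norm_quad_gramResolvent_le τ Y hz _) (norm_nonneg _)
    ((abs_nonneg _).trans (hτ α))

lemma integral_normalizedCountingMeasure {ι E : Type*} [Fintype ι] [NormedAddCommGroup E]
    [NormedSpace ℝ E] [CompleteSpace E] (x : ι → ℝ) (f : ℝ → E) :
    ∫ t, f t ∂(normalizedCountingMeasure x : Measure ℝ)
      = (Fintype.card ι : ℝ)⁻¹ • ∑ i, f (x i) := by
  have e : (normalizedCountingMeasure x : Measure ℝ)
      = ((Fintype.card ι : ℝ≥0)⁻¹) • ∑ i, Measure.dirac (x i) := by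
    rw [normalizedCountingMeasure, FiniteMeasure.toMeasure_smul, FiniteMeasure.toMeasure_sum]
    rfl
  rw [e, integral_smul_nnreal_measure, integral_finsetSum_measure]
  · simp only [integral_dirac]
    rfl
  · intro i _
    exact integrable_dirac (by simp)

/-- The normalized trace of the resolvent is the Stieltjes transform of the normalized counting
measure of the eigenvalues. -/
lemma gramTrace_eq_integral (τ : A → ℝ) (Y : A → I → ℝ) {z : ℂ} (hz : 0 < z.im) :
    gramTrace τ Y z = ∫ x : ℝ, ((x : ℂ) - z)⁻¹
      ∂(normalizedCountingMeasure (weightedGram_isHermitian τ Y).eigenvalues : Measure ℝ) := by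
  rw [integral_normalizedCountingMeasure]
  have hS := weightedGram_isHermitian τ Y
  have hsp := hS.spectral_theorem
  rw [Unitary.conjStarAlgAut_apply] at hsp
  have h1 : (hS.eigenvectorUnitary : Matrix I I ℝ) * star (hS.eigenvectorUnitary : Matrix I I ℝ)
      = 1 := Unitary.coe_mul_star_self _
  have h2 : star (hS.eigenvectorUnitary : Matrix I I ℝ) * (hS.eigenvectorUnitary : Matrix I I ℝ)
      = 1 := Unitary.coe_star_mul_self _
  set U : Matrix I I ℝ := (hS.eigenvectorUnitary : Matrix I I ℝ)
  set ev := hS.eigenvalues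
  -- The diagonalization is over the reals; the entrywise inclusion, being a ring homomorphism,
  -- carries it to complex matrices.
  let F : Matrix I I ℝ →+* Matrix I I ℂ := Complex.ofRealHom.mapMatrix
  have g1 : F U * F (star U) = 1 := by rw [← map_mul, h1, map_one]
  have g2 : F (star U) * F U = 1 := by rw [← map_mul, h2, map_one]
  have hne : ∀ i, (ev i : ℂ) - z ≠ 0 := fun i h => by
    have := congrArg Complex.im h
    simp at this
    exact hz.ne' this
  have e1 : shifted (weightedGram τ Y) z
      = F U * diagonal (fun i => (ev i : ℂ) - z) * F (star U) := by
    have : diagonal (fun i => (ev i : ℂ) - z)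
        = F (diagonal (RCLike.ofReal ∘ ev)) - z • (1 : Matrix I I ℂ) := by
      ext i j
      by_cases hij : i = j
      · subst hij; simp [F]
      · simp [F, hij]
    rw [this, mul_sub, sub_mul, ← map_mul, ← map_mul, Matrix.mul_smul, Matrix.smul_mul, mul_one, g1]
    conv_lhs => rw [hsp]
    rfl
  have e2 : gramResolvent τ Y z
      = F U * diagonal (fun i => ((ev i : ℂ) - z)⁻¹) * F (star U) := by
    refine inv_eq_right_inv ?_
    rw [e1]
    calc _ = F U * (diagonal (fun i => (ev i : ℂ) - z) * ((F (star U) * F U) *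
            diagonal (fun i => ((ev i : ℂ) - z)⁻¹))) * F (star U) := by
          simp only [Matrix.mul_assoc]
      _ = 1 := by
          rw [g2, one_mul, diagonal_mul_diagonal]
          simp [hne, g1]
  rw [gramTrace, e2, trace_mul_comm, ← Matrix.mul_assoc, g2, one_mul, trace_diagonal,
    div_eq_inv_mul, ← Complex.ofReal_natCast, ← Complex.ofReal_inv, Complex.real_smul]

end Gram
end

noncomputable section

/-! ### Quadratic forms at tensor products of independent vectors -/

section TensorVariance

open Matrix

lemma Fin.sum_cons_fun {M : Type*} [AddCommMonoid M] {n k : ℕ} (f : (Fin (k + 1) → Fin n) → M) :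
    ∑ J, f J = ∑ i : Fin n, ∑ a : Fin k → Fin n, f (Fin.cons i a) := by
  rw [← (Fin.consEquiv fun _ => Fin n).sum_comp, Fintype.sum_prod_type]
  rfl

lemma tensorVector_cons {n k : ℕ} (y : Fin n → ℝ) (y' : Fin k → Fin n → ℝ) (i : Fin n)
    (a : Fin k → Fin n) :
    tensorVector (Fin.cons y y' : Fin (k + 1) → Fin n → ℝ) (Fin.cons i a)
      = y i * tensorVector y' a := by
  simp [tensorVector, Fin.prod_univ_succ]

lemma continuous_tensorVector {n k : ℕ} (a : Fin k → Fin n) :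
    Continuous fun y : Fin k → Fin n → ℝ => tensorVector y a := by
  unfold tensorVector
  fun_prop

/-- The tensor product of a vector and a `k`-tensor. -/
def tensorCons {n k : ℕ} (u : Fin n → ℂ) (w : (Fin k → Fin n) → ℂ) : (Fin (k + 1) → Fin n) → ℂ :=
  fun J => u (J 0) * w (Fin.tail J)

lemma tensorCons_cons {n k : ℕ} (u : Fin n → ℂ) (w : (Fin k → Fin n) → ℂ) (i : Fin n)
    (a : Fin k → Fin n) : tensorCons u w (Fin.cons i a) = u i * w a := by
  simp [tensorCons]

lemma l2norm_tensorCons {n k : ℕ} (u : Fin n → ℂ) (w : (Fin k → Fin n) → ℂ) :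
    l2norm (tensorCons u w) = l2norm u * l2norm w := by
  unfold l2norm
  rw [← Real.sqrt_mul (Finset.sum_nonneg fun _ _ => by positivity), Fin.sum_cons_fun,
    Finset.sum_mul_sum]
  simp only [tensorCons_cons, norm_mul, mul_pow]

lemma cvec_tensorVector_cons {n k : ℕ} (y : Fin n → ℝ) (y' : Fin k → Fin n → ℝ) :
    cvec (tensorVector (Fin.cons y y' : Fin (k + 1) → Fin n → ℝ))
      = tensorCons (cvec y) (cvec (tensorVector y')) := by
  ext J
  obtain ⟨i, a, rfl⟩ : ∃ i a, J = Fin.cons i a :=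
    ⟨J 0, Fin.tail J, (Fin.cons_self_tail J).symm⟩
  rw [tensorCons_cons, cvec, tensorVector_cons, Complex.ofReal_mul]
  rfl

/-- The contraction of all tensor factors but the first with `w`. -/
def contractTail {n k : ℕ} (H : Matrix (Fin (k + 1) → Fin n) (Fin (k + 1) → Fin n) ℂ)
    (w : (Fin k → Fin n) → ℂ) : Matrix (Fin n) (Fin n) ℂ :=
  fun i j => ∑ a, ∑ b, w a * H (Fin.cons i a) (Fin.cons j b) * w b

/-- The normalized partial trace over the first tensor factor. -/
def partialTrace {n k : ℕ} (H : Matrix (Fin (k + 1) → Fin n) (Fin (k + 1) → Fin n) ℂ) :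
    Matrix (Fin k → Fin n) (Fin k → Fin n) ℂ :=
  fun a b => (n : ℂ)⁻¹ * ∑ i, H (Fin.cons i a) (Fin.cons i b)

lemma dotProduct_contractTail {n k : ℕ}
    (H : Matrix (Fin (k + 1) → Fin n) (Fin (k + 1) → Fin n) ℂ)
    (w : (Fin k → Fin n) → ℂ) (u v : Fin n → ℂ) :
    u ⬝ᵥ contractTail H w *ᵥ v = tensorCons u w ⬝ᵥ H *ᵥ tensorCons v w := by
  simp only [dotProduct, mulVec, contractTail, Fin.sum_cons_fun, tensorCons_cons, Finset.mul_sum,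
    Finset.sum_mul]
  refine Finset.sum_congr rfl fun i _ => ?_
  rw [Finset.sum_comm]
  refine Finset.sum_congr rfl fun a _ => Finset.sum_congr rfl fun j _ =>
    Finset.sum_congr rfl fun b _ => ?_
  ring

/-- The left side is the mean of the form over the first factor with the others frozen. It is again
a quadratic form, in one factor fewer, which drives the induction. -/
lemma trace_contractTail {n k : ℕ}
    (H : Matrix (Fin (k + 1) → Fin n) (Fin (k + 1) → Fin n) ℂ) (w : (Fin k → Fin n) → ℂ) :
    (contractTail H w).trace / n = w ⬝ᵥ partialTrace H *ᵥ w := by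
  simp only [dotProduct, mulVec, contractTail, partialTrace, trace, diag, Finset.mul_sum,
    Finset.sum_mul, Finset.sum_div]
  rw [Finset.sum_comm]
  refine Finset.sum_congr rfl fun a _ => ?_
  rw [Finset.sum_comm]
  refine Finset.sum_congr rfl fun b _ => Finset.sum_congr rfl fun i _ => ?_
  ring

lemma trace_partialTrace {n k : ℕ}
    (H : Matrix (Fin (k + 1) → Fin n) (Fin (k + 1) → Fin n) ℂ) :
    (partialTrace H).trace / (n : ℂ) ^ k = H.trace / (n : ℂ) ^ (k + 1) := by
  simp only [partialTrace, trace, diag, Fin.sum_cons_fun, ← Finset.mul_sum]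
  rw [Finset.sum_comm, pow_succ, div_mul_eq_div_div, div_right_comm, div_eq_inv_mul _ (n : ℂ)]

/-- The factor `‖w‖²` is random in the application; after squaring it requires the fourth moment of
the norm of the tensor. -/
lemma BilinBound.contractTail {n k : ℕ}
    {H : Matrix (Fin (k + 1) → Fin n) (Fin (k + 1) → Fin n) ℂ} {h : ℝ} (hH : BilinBound H h)
    (w : (Fin k → Fin n) → ℂ) : BilinBound (contractTail H w) (h * l2norm w ^ 2) := fun u v => by
  rw [dotProduct_contractTail]
  refine (hH _ _).trans_eq ?_
  rw [l2norm_tensorCons, l2norm_tensorCons]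
  ring

lemma l2norm_single {n : ℕ} (i : Fin n) : l2norm (Pi.single i (1 : ℂ)) = 1 := by
  have : l2norm (Pi.single i (1 : ℂ)) ^ 2 = 1 := by
    rw [l2norm_sq, Finset.sum_eq_single i]
    · simp
    · intro j _ hj; simp [hj]
    · simp
  exact (pow_eq_one_iff_of_nonneg (l2norm_nonneg _) two_ne_zero).1 this

/-- The partial trace is the average over `i` of the compressions of `H` to `e_i ⊗ ·`, each bounded
by `h`. -/
lemma BilinBound.partialTrace {n k : ℕ} (hn : 0 < n)
    {H : Matrix (Fin (k + 1) → Fin n) (Fin (k + 1) → Fin n) ℂ} {h : ℝ} (hH : BilinBound H h) :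
    BilinBound (partialTrace H) h := fun u v => by
  have e : u ⬝ᵥ _root_.partialTrace H *ᵥ v = (n : ℂ)⁻¹ * ∑ i : Fin n,
      tensorCons (Pi.single i 1) u ⬝ᵥ H *ᵥ tensorCons (Pi.single i 1) v := by
    simp only [dotProduct, mulVec, _root_.partialTrace, Fin.sum_cons_fun, tensorCons_cons,
      Finset.mul_sum, Finset.sum_mul, Pi.single_apply]
    simp only [ite_mul, mul_ite, one_mul, zero_mul, mul_zero, Finset.sum_ite_irrel,
      Finset.sum_const_zero, Finset.sum_ite_eq', Finset.mem_univ, if_true]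
    conv_rhs => rw [Finset.sum_comm]
    refine Finset.sum_congr rfl fun a _ => ?_
    rw [Finset.sum_comm]
    refine Finset.sum_congr rfl fun i _ => Finset.sum_congr rfl fun b _ => ?_
    ring
  rw [e, norm_mul, norm_inv, Complex.norm_natCast, inv_mul_le_iff₀ (by exact_mod_cast hn)]
  refine (norm_sum_le _ _).trans ((Finset.sum_le_sum fun i _ => hH _ _).trans_eq ?_)
  simp only [l2norm_tensorCons, l2norm_single, one_mul]
  simp

lemma sum_sq_tensorVector_cons {n k : ℕ} (y : Fin n → ℝ) (y' : Fin k → Fin n → ℝ) :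
    ∑ J, tensorVector (Fin.cons y y' : Fin (k + 1) → Fin n → ℝ) J ^ 2
      = (∑ i, y i ^ 2) * ∑ a, tensorVector y' a ^ 2 := by
  simp only [Fin.sum_cons_fun, tensorVector_cons, mul_pow, Finset.sum_mul_sum]

/-- The law `ν` of a random vector of `ℝⁿ` has quadratic forms `(H y, y)` with mean the normalized
trace and variance at most `‖H‖² δ`. -/
def HasQuadVariance {n : ℕ} (ν : Measure (Fin n → ℝ)) (δ : ℝ) : Prop :=
  ∀ (H : Matrix (Fin n) (Fin n) ℂ) (h : ℝ), 0 ≤ h → BilinBound H h →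
    ∫⁻ y, ENNReal.ofReal (‖cvec y ⬝ᵥ H *ᵥ cvec y - H.trace / n‖ ^ 2) ∂ν ≤ ENNReal.ofReal (h ^ 2 * δ)

lemma bilinBound_one {I : Type*} [Fintype I] [DecidableEq I] :
    BilinBound (1 : Matrix I I ℂ) 1 := fun u v => by
  rw [one_mulVec, one_mul]; exact norm_dotProduct_le u v

lemma cvec_dotProduct_self {I : Type*} [Fintype I] (y : I → ℝ) :
    cvec y ⬝ᵥ cvec y = ((∑ i, y i ^ 2 : ℝ) : ℂ) := by
  simp [dotProduct, cvec, sq]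

lemma continuous_quad {I : Type*} [Fintype I] (H : Matrix I I ℂ) :
    Continuous fun y : I → ℝ => cvec y ⬝ᵥ H *ᵥ cvec y := by
  unfold cvec dotProduct mulVec dotProduct
  fun_prop

lemma continuous_quad_tensorVector {n k : ℕ}
    (H : Matrix (Fin k → Fin n) (Fin k → Fin n) ℂ) :
    Continuous fun y : Fin k → Fin n → ℝ => cvec (tensorVector y) ⬝ᵥ H *ᵥ cvec (tensorVector y) :=
  (continuous_quad H).comp (continuous_pi continuous_tensorVector)

lemma HasQuadVariance.lintegral_norm_sq_sub_one {n : ℕ} (hn : 0 < n) {ν : Measure (Fin n → ℝ)}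
    {δ : ℝ} (hν : HasQuadVariance ν δ) :
    ∫⁻ y, ENNReal.ofReal ((∑ i, y i ^ 2 - 1) ^ 2) ∂ν ≤ ENNReal.ofReal δ := by
  have h := hν 1 1 zero_le_one bilinBound_one
  have hn' : (n : ℂ) ≠ 0 := by exact_mod_cast hn.ne'
  simp only [one_mulVec, cvec_dotProduct_self, trace_one, Fintype.card_fin, div_self hn', one_pow,
    one_mul] at h
  convert h using 4 with y
  rw [← Complex.ofReal_one, ← Complex.ofReal_sub, Complex.norm_real, Real.norm_eq_abs, sq_abs]

/-- From `x² ≤ 2 (x - 1)² + 2` at `x = ‖y‖²`; with `δ ≤ 1` the total is `2 + 2`. -/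
lemma HasQuadVariance.lintegral_norm_pow_four {n : ℕ} (hn : 0 < n) {ν : Measure (Fin n → ℝ)}
    [IsProbabilityMeasure ν] {δ : ℝ} (hδ : δ ≤ 1) (hν : HasQuadVariance ν δ) :
    ∫⁻ y, ENNReal.ofReal ((∑ i, y i ^ 2) ^ 2) ∂ν ≤ ENNReal.ofReal 4 := by
  calc ∫⁻ y, ENNReal.ofReal ((∑ i, y i ^ 2) ^ 2) ∂ν
      ≤ ∫⁻ y, (ENNReal.ofReal 2 * ENNReal.ofReal ((∑ i, y i ^ 2 - 1) ^ 2) + ENNReal.ofReal 2) ∂ν := by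
        refine lintegral_mono fun y => ?_
        rw [← ENNReal.ofReal_mul zero_le_two, ← ENNReal.ofReal_add (by positivity) (by positivity)]
        refine ENNReal.ofReal_le_ofReal ?_
        nlinarith [sq_nonneg (∑ i, y i ^ 2 - 2)]
    _ = ENNReal.ofReal 2 * ∫⁻ y, ENNReal.ofReal ((∑ i, y i ^ 2 - 1) ^ 2) ∂ν + ENNReal.ofReal 2 := by
        rw [lintegral_add_right _ measurable_const, lintegral_const_mul' _ _ ENNReal.ofReal_ne_top]
        simp
    _ ≤ ENNReal.ofReal 2 * ENNReal.ofReal 1 + ENNReal.ofReal 2 := by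
        gcongr
        exact (hν.lintegral_norm_sq_sub_one hn).trans (ENNReal.ofReal_le_ofReal hδ)
    _ = ENNReal.ofReal 4 := by
        rw [← ENNReal.ofReal_mul zero_le_two, ← ENNReal.ofReal_add (by positivity) (by positivity)]
        norm_num

lemma lintegral_pi_succ {n k : ℕ} (ν : Measure (Fin n → ℝ)) [IsProbabilityMeasure ν]
    {f : (Fin (k + 1) → Fin n → ℝ) → ℝ≥0∞} (hf : Measurable f) :
    ∫⁻ y, f y ∂(Measure.pi fun _ => ν)
      = ∫⁻ y', ∫⁻ y, f (Fin.cons y y') ∂ν ∂(Measure.pi fun _ : Fin k => ν) := by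
  have h := (measurePreserving_piFinSuccAbove (fun _ : Fin (k + 1) => ν) 0).symm
  rw [← h.lintegral_comp hf, lintegral_prod_symm]
  · simp [MeasurableEquiv.piFinSuccAbove, Fin.insertNthEquiv]
  · exact (hf.comp h.measurable).aemeasurable

/-- The norm of a tensor product is the product of the norms, and independence multiplies the
moments. -/
lemma HasQuadVariance.lintegral_tensor_norm_pow_four {n : ℕ} (hn : 0 < n)
    {ν : Measure (Fin n → ℝ)} [IsProbabilityMeasure ν] {δ : ℝ} (hδ : δ ≤ 1)
    (hν : HasQuadVariance ν δ) (k : ℕ) :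
    ∫⁻ y, ENNReal.ofReal ((∑ a, tensorVector y a ^ 2) ^ 2) ∂(Measure.pi fun _ : Fin k => ν)
      ≤ ENNReal.ofReal (4 ^ k) := by
  have hm : ∀ k, Measurable fun y : Fin k → Fin n → ℝ =>
      ENNReal.ofReal ((∑ a, tensorVector y a ^ 2) ^ 2) := fun k => by
    have := fun a => (continuous_tensorVector (n := n) (k := k) a).measurable
    fun_prop
  induction k with
  | zero => simp [tensorVector]
  | succ k ih =>
    rw [lintegral_pi_succ ν (hm _)]
    simp only [sum_sq_tensorVector_cons, mul_pow]
    calc ∫⁻ y', ∫⁻ y, ENNReal.ofReal ((∑ i, y i ^ 2) ^ 2 * (∑ a, tensorVector y' a ^ 2) ^ 2) ∂ν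
            ∂(Measure.pi fun _ : Fin k => ν)
        = ∫⁻ y', (∫⁻ y, ENNReal.ofReal ((∑ i, y i ^ 2) ^ 2) ∂ν) *
            ENNReal.ofReal ((∑ a, tensorVector y' a ^ 2) ^ 2) ∂(Measure.pi fun _ : Fin k => ν) := by
          refine lintegral_congr fun y' => ?_
          rw [← lintegral_mul_const' _ _ ENNReal.ofReal_ne_top]
          simp only [ENNReal.ofReal_mul (sq_nonneg _)]
      _ ≤ ∫⁻ y', ENNReal.ofReal 4 *
            ENNReal.ofReal ((∑ a, tensorVector y' a ^ 2) ^ 2) ∂(Measure.pi fun _ : Fin k => ν) := by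
          gcongr
          exact hν.lintegral_norm_pow_four hn hδ
      _ ≤ ENNReal.ofReal 4 * ENNReal.ofReal (4 ^ k) := by
          rw [lintegral_const_mul' _ _ ENNReal.ofReal_ne_top]
          gcongr
      _ = _ := by
          rw [← ENNReal.ofReal_mul (by norm_num), pow_succ, mul_comm]

/-- The constant in the variance bound for quadratic forms at a `k`-fold tensor product. -/
def tensorVarianceConst : ℕ → ℝ
  | 0 => 0
  | k + 1 => 2 * 4 ^ k + 2 * tensorVarianceConst k

lemma tensorVarianceConst_nonneg : ∀ k, 0 ≤ tensorVarianceConst k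
  | 0 => le_rfl
  | k + 1 => by
    have := tensorVarianceConst_nonneg k
    unfold tensorVarianceConst
    positivity

/-- The deviation is split at the conditional mean given all factors but the first, and `(a + b)² ≤
2a² + 2b²` is used. The first part has conditional variance at most `h² ‖w‖⁴ δ`, hence `h² 4ᵏ δ` on
average. The second is the deviation of the partial trace, covered by induction. This is the
recursion in `tensorVarianceConst`. -/
lemma HasQuadVariance.lintegral_tensor {n : ℕ} (hn : 0 < n)
    {ν : Measure (Fin n → ℝ)} [IsProbabilityMeasure ν] {δ : ℝ} (hδ0 : 0 ≤ δ) (hδ : δ ≤ 1)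
    (hν : HasQuadVariance ν δ) (k : ℕ) (H : Matrix (Fin k → Fin n) (Fin k → Fin n) ℂ) {h : ℝ}
    (hh : 0 ≤ h) (hH : BilinBound H h) :
    ∫⁻ y, ENNReal.ofReal (‖cvec (tensorVector y) ⬝ᵥ H *ᵥ cvec (tensorVector y)
        - H.trace / (n : ℂ) ^ k‖ ^ 2) ∂(Measure.pi fun _ : Fin k => ν)
      ≤ ENNReal.ofReal (tensorVarianceConst k * (h ^ 2 * δ)) := by
  have hm : ∀ (k : ℕ) (H : Matrix (Fin k → Fin n) (Fin k → Fin n) ℂ) (c : ℂ),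
      Measurable fun y : Fin k → Fin n → ℝ =>
      ENNReal.ofReal (‖cvec (tensorVector y) ⬝ᵥ H *ᵥ cvec (tensorVector y) - c‖ ^ 2) :=
    fun k H c => by
      have := (continuous_quad_tensorVector H).measurable
      fun_prop
  have hm4 : ∀ k, Measurable fun y : Fin k → Fin n → ℝ =>
      ENNReal.ofReal ((∑ a, tensorVector y a ^ 2) ^ 2) := fun k => by
    have := fun a => (continuous_tensorVector (n := n) (k := k) a).measurable
    fun_prop
  induction k with
  -- The empty tensor product is the scalar `1`, so there is no deviation.
  | zero =>
    have : ∀ y : Fin 0 → Fin n → ℝ, cvec (tensorVector y) ⬝ᵥ H *ᵥ cvec (tensorVector y)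
        - H.trace / (n : ℂ) ^ 0 = 0 := fun y => by
      simp [dotProduct, mulVec, cvec, tensorVector, trace]
    simp only [this]
    simp
  | succ k ih =>
    rw [lintegral_pi_succ ν (hm _ _ _)]
    have hih := ih (partialTrace H) (hH.partialTrace hn)
    have hpt : ∀ y' : Fin k → Fin n → ℝ,
        ∫⁻ y, ENNReal.ofReal (‖cvec (tensorVector (Fin.cons y y' : Fin (k + 1) → Fin n → ℝ)) ⬝ᵥ
          H *ᵥ cvec (tensorVector (Fin.cons y y' : Fin (k + 1) → Fin n → ℝ))
            - H.trace / (n : ℂ) ^ (k + 1)‖ ^ 2) ∂ν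
        ≤ ENNReal.ofReal (2 * (h ^ 2 * δ)) * ENNReal.ofReal ((∑ a, tensorVector y' a ^ 2) ^ 2)
          + ENNReal.ofReal 2 * ENNReal.ofReal (‖cvec (tensorVector y') ⬝ᵥ
            partialTrace H *ᵥ cvec (tensorVector y')
            - (partialTrace H).trace / (n : ℂ) ^ k‖ ^ 2) := fun y' => by
      set w := cvec (tensorVector y') with hw
      have h1 := hν (contractTail H w) (h * l2norm w ^ 2) (by positivity) (hH.contractTail w)
      calc _ ≤ ∫⁻ y, (ENNReal.ofReal 2 * ENNReal.ofReal (‖cvec y ⬝ᵥ contractTail H w *ᵥ cvec y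
              - (contractTail H w).trace / n‖ ^ 2)
            + ENNReal.ofReal 2 * ENNReal.ofReal (‖w ⬝ᵥ partialTrace H *ᵥ w
              - (partialTrace H).trace / (n : ℂ) ^ k‖ ^ 2)) ∂ν := by
            refine lintegral_mono fun y => ?_
            rw [← ENNReal.ofReal_mul zero_le_two, ← ENNReal.ofReal_mul zero_le_two,
              ← ENNReal.ofReal_add (by positivity) (by positivity), cvec_tensorVector_cons,
              ← dotProduct_contractTail, trace_contractTail, trace_partialTrace]
            refine ENNReal.ofReal_le_ofReal ?_
            generalize cvec y ⬝ᵥ contractTail H w *ᵥ cvec y = p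
            generalize w ⬝ᵥ partialTrace H *ᵥ w = q
            generalize H.trace / (n : ℂ) ^ (k + 1) = r
            have := norm_sub_le_norm_sub_add_norm_sub p q r
            nlinarith [norm_nonneg (p - r), sq_nonneg (‖p - q‖ - ‖q - r‖)]
        _ ≤ _ := by
            rw [lintegral_add_right _ measurable_const,
              lintegral_const_mul' _ _ ENNReal.ofReal_ne_top]
            simp only [lintegral_const, measure_univ, mul_one]
            refine add_le_add ((mul_le_mul_right h1 _).trans_eq ?_) le_rfl
            rw [hw, l2norm_cvec_sq, ← ENNReal.ofReal_mul zero_le_two,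
              ← ENNReal.ofReal_mul (by positivity)]
            congr 1; ring
    refine (lintegral_mono hpt).trans ?_
    rw [lintegral_add_left ((hm4 k).const_mul _), lintegral_const_mul' _ _ ENNReal.ofReal_ne_top,
      lintegral_const_mul' _ _ ENNReal.ofReal_ne_top]
    refine (add_le_add (mul_le_mul_right (hν.lintegral_tensor_norm_pow_four hn hδ k) _)
      (mul_le_mul_right hih _)).trans_eq ?_
    have := tensorVarianceConst_nonneg k
    rw [← ENNReal.ofReal_mul (by positivity), ← ENNReal.ofReal_mul zero_le_two,
      ← ENNReal.ofReal_add (by positivity) (by positivity)]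
    congr 1
    rw [tensorVarianceConst]; ring

/-- A good normalized isotropic vector satisfies the variance bound. -/
lemma IsNormalizedIsotropic.hasQuadVariance {n : ℕ} {ν : Measure (Fin n → ℝ)}
    [IsProbabilityMeasure ν] (hiso : IsNormalizedIsotropic ν) {δ : ℝ} (hδ : 0 ≤ δ)
    (hvar : ∀ H : Matrix (Fin n) (Fin n) ℂ, MemLp (quadForm H) 2 ν ∧
      ∫ y, ‖quadForm H y - ∫ y', quadForm H y' ∂ν‖ ^ 2 ∂ν
        ≤ ‖Matrix.toEuclideanCLM (n := Fin n) (𝕜 := ℂ) H‖ ^ 2 * δ) :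
    HasQuadVariance ν δ := by
  intro H h hh hH
  have hq : ∀ y, quadForm H y = cvec y ⬝ᵥ H *ᵥ cvec y := fun y => by
    simp only [quadForm, dotProduct, mulVec, cvec, Finset.mul_sum]
    refine Finset.sum_congr rfl fun i _ => Finset.sum_congr rfl fun j _ => by ring
  have hint : ∀ i j, Integrable (fun y : Fin n → ℝ => y i * y j) ν := fun i j =>
    (hiso.memLp i).integrable_mul (hiso.memLp j)
  have hmean : ∫ y, quadForm H y ∂ν = H.trace / n := by
    have hint' : ∀ i j, Integrable (fun y : Fin n → ℝ => H i j * (y j : ℂ) * (y i : ℂ)) ν :=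
      fun i j => by
        have := ((hint j i).ofReal (𝕜 := ℂ)).const_mul (H i j)
        simpa [mul_assoc] using this
    unfold quadForm
    rw [integral_finsetSum _ fun i _ => integrable_finsetSum _ fun j _ => hint' i j]
    have : ∀ i j, ∫ y : Fin n → ℝ, H i j * (y j : ℂ) * (y i : ℂ) ∂ν
        = if j = i then H i j * (n : ℂ)⁻¹ else 0 := fun i j => by
      have e : ∀ y : Fin n → ℝ, H i j * (y j : ℂ) * (y i : ℂ) = H i j * ((y j * y i : ℝ) : ℂ) :=
        fun y => by push_cast; ring
      simp only [e]
      rw [integral_const_mul, integral_complex_ofReal, hiso.cov]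
      split_ifs <;> simp
    simp only [integral_finsetSum _ fun j _ => hint' _ j, this]
    simp [trace, div_eq_mul_inv, Finset.sum_mul]
  -- Testing the bilinear bound on `u = conj (H x)` and `v = x` gives `‖H x‖² ≤ h ‖H x‖ ‖x‖`.
  have hop : ‖Matrix.toEuclideanCLM (n := Fin n) (𝕜 := ℂ) H‖ ≤ h := by
    refine ContinuousLinearMap.opNorm_le_bound _ hh fun x => ?_
    set w := Matrix.toEuclideanCLM (n := Fin n) (𝕜 := ℂ) H x with hw
    have hwx : ⇑w = H *ᵥ x := by
      ext i; simp [hw]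
    have nrm : ∀ u : EuclideanSpace ℂ (Fin n), l2norm ⇑u = ‖u‖ := fun u => by
      rw [EuclideanSpace.norm_eq, l2norm]
    have h1 := hH (star ⇑w) x
    rw [← hwx, star_dotProduct_self_eq, l2norm_star, nrm, nrm, Complex.norm_real, norm_pow,
      norm_norm] at h1
    rcases (norm_nonneg w).eq_or_lt with h0 | h0
    · rw [← h0]; positivity
    · nlinarith
  obtain ⟨hLp, hv⟩ := hvar H
  rw [hmean] at hv
  have hint2 : Integrable (fun y => ‖quadForm H y - H.trace / n‖ ^ 2) ν :=
    (hLp.sub (memLp_const (H.trace / n))).norm.integrable_sq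
  simp only [← hq]
  rw [← ofReal_integral_eq_lintegral_ofReal hint2 (ae_of_all _ fun _ => by positivity)]
  refine ENNReal.ofReal_le_ofReal (hv.trans ?_)
  gcongr

end TensorVariance
end

noncomputable section

/-! ### Stieltjes transforms of probability measures on the line -/

section Stieltjes

lemma ofReal_sub_ne_zero {z : ℂ} (hz : z.im ≠ 0) (x : ℝ) : (x : ℂ) - z ≠ 0 := fun h => by
  have := congrArg Complex.im h
  simp at this
  exact hz this

lemma norm_inv_ofReal_sub_le {z : ℂ} (hz : z.im ≠ 0) (x : ℝ) : ‖((x : ℂ) - z)⁻¹‖ ≤ |z.im|⁻¹ := by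
  rw [norm_inv]
  refine inv_anti₀ (abs_pos.2 hz) ?_
  simpa using Complex.abs_im_le_norm ((x : ℂ) - z)

lemma continuous_inv_ofReal_sub {z : ℂ} (hz : z.im ≠ 0) :
    Continuous fun x : ℝ => ((x : ℂ) - z)⁻¹ :=
  (by fun_prop : Continuous fun x : ℝ => (x : ℂ) - z).inv₀ (ofReal_sub_ne_zero hz)

/-- The function `x ↦ (x - z)⁻¹` as a bounded continuous function. -/
def resolventBCF {z : ℂ} (hz : z.im ≠ 0) : ℝ →ᵇ ℂ :=
  BoundedContinuousFunction.ofNormedAddCommGroup (fun x : ℝ => ((x : ℂ) - z)⁻¹)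
    (continuous_inv_ofReal_sub hz) |z.im|⁻¹ (norm_inv_ofReal_sub_le hz)

lemma integrable_inv_ofReal_sub (μ : Measure ℝ) [IsFiniteMeasure μ] {z : ℂ} (hz : z.im ≠ 0) :
    Integrable (fun x : ℝ => ((x : ℂ) - z)⁻¹) μ :=
  (resolventBCF hz).integrable μ

lemma tendsto_stieltjesTransform {ι : Type*} {l : Filter ι} {μ : ι → ProbabilityMeasure ℝ}
    {N : ProbabilityMeasure ℝ} (h : Tendsto μ l (𝓝 N)) {z : ℂ} (hz : z.im ≠ 0) :
    Tendsto (fun j => stieltjesTransform (μ j) z) l (𝓝 (stieltjesTransform N z)) := by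
  simp only [stieltjesTransform_eq]
  exact (ProbabilityMeasure.tendsto_iff_forall_integral_rclike_tendsto ℂ).1 h (resolventBCF hz)

lemma im_inv_ofReal_sub (z : ℂ) (x : ℝ) :
    (((x : ℂ) - z)⁻¹).im = z.im / Complex.normSq ((x : ℂ) - z) := by
  rw [Complex.inv_im]
  simp

lemma im_stieltjesTransform_pos (N : ProbabilityMeasure ℝ) {z : ℂ} (hz : 0 < z.im) :
    0 < (stieltjesTransform N z).im := by
  have hint := integrable_inv_ofReal_sub (N : Measure ℝ) hz.ne'
  have e : (stieltjesTransform N z).im = ∫ x : ℝ, (((x : ℂ) - z)⁻¹).im ∂(N : Measure ℝ) := by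
    rw [stieltjesTransform_eq]
    exact (integral_im hint).symm
  have hpos : ∀ x : ℝ, 0 < (((x : ℂ) - z)⁻¹).im := fun x => by
    rw [im_inv_ofReal_sub]
    exact div_pos hz (Complex.normSq_pos.2 (ofReal_sub_ne_zero hz.ne' x))
  rw [e, integral_pos_iff_support_of_nonneg (fun x => (hpos x).le) hint.im]
  have : (Function.support fun x : ℝ => (((x : ℂ) - z)⁻¹).im) = Set.univ := by
    ext x; simpa using (hpos x).ne'
  rw [this]
  simp

lemma stieltjesTransform_conj (N : ProbabilityMeasure ℝ) (z : ℂ) :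
    stieltjesTransform N (starRingEnd ℂ z) = starRingEnd ℂ (stieltjesTransform N z) := by
  rw [stieltjesTransform_eq, stieltjesTransform_eq, ← integral_conj]
  simp

lemma analyticOnNhd_stieltjesTransform (N : ProbabilityMeasure ℝ) :
    AnalyticOnNhd ℂ (stieltjesTransform N) {z : ℂ | z.im ≠ 0} := by
  have hopen : IsOpen {z : ℂ | z.im ≠ 0} := isOpen_ne_fun Complex.continuous_im continuous_const
  rw [← hopen.analyticOn_iff_analyticOnNhd]
  refine (analyticOn_resolventTransform (𝕜 := ℝ) (μ := (N : Measure ℝ))).mono ?_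
  rintro z hz ⟨x, -, rfl⟩
  simp at hz

/-- At `z = i r` the real part of `1 + z s(z)` is `∫ x² / (x² + r²)`, whose integrand is at least
`1/2` where `|x| > r`. -/
lemma measure_norm_gt_le (N : ProbabilityMeasure ℝ) {r : ℝ} (hr : 0 < r) :
    (N : Measure ℝ) {x | r < ‖x‖}
      ≤ ENNReal.ofReal (2 * ‖1 + (r * Complex.I) * stieltjesTransform N (r * Complex.I)‖) := by
  set z : ℂ := r * Complex.I with hz
  have hzim : z.im = r := by simp [hz]
  have hz0 : z.im ≠ 0 := by rw [hzim]; exact hr.ne'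
  have hint := integrable_inv_ofReal_sub (N : Measure ℝ) hz0
  have e : 1 + z * stieltjesTransform N z
      = ∫ x : ℝ, (1 + z * ((x : ℂ) - z)⁻¹) ∂(N : Measure ℝ) := by
    rw [integral_add (integrable_const _) (hint.const_mul z), integral_const_mul,
      stieltjesTransform_eq]
    simp
  have hint2 : Integrable (fun x : ℝ => 1 + z * ((x : ℂ) - z)⁻¹) (N : Measure ℝ) :=
    (integrable_const _).add (hint.const_mul z)
  have hre : ∀ x : ℝ, (1 + z * ((x : ℂ) - z)⁻¹).re = x ^ 2 / (x ^ 2 + r ^ 2) := fun x => by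
    have hne : x ^ 2 + r ^ 2 ≠ 0 := by positivity
    simp [hz, Complex.inv_re, Complex.inv_im, Complex.normSq_apply]
    field_simp
    ring
  have h1 : ∫ x : ℝ, x ^ 2 / (x ^ 2 + r ^ 2) ∂(N : Measure ℝ) ≤ ‖1 + z * stieltjesTransform N z‖ := by
    rw [e]
    refine le_trans (le_of_eq ?_) (Complex.re_le_norm _)
    simp only [← hre]
    exact integral_re hint2
  have hint3 : Integrable (fun x : ℝ => x ^ 2 / (x ^ 2 + r ^ 2)) (N : Measure ℝ) := by
    simp only [← hre]; exact hint2.re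
  have hset : MeasurableSet {x : ℝ | r < ‖x‖} := measurableSet_lt measurable_const measurable_norm
  have h2 : (N : Measure ℝ).real {x | r < ‖x‖} * (1 / 2)
      ≤ ∫ x : ℝ, x ^ 2 / (x ^ 2 + r ^ 2) ∂(N : Measure ℝ) := by
    rw [← smul_eq_mul, ← integral_indicator_const (μ := (N : Measure ℝ)) (1 / 2 : ℝ) hset]
    refine integral_mono ((integrable_const _).indicator hset) hint3 fun x => ?_
    by_cases hx : x ∈ {x : ℝ | r < ‖x‖}
    · rw [Set.indicator_of_mem hx]
      have hx' : r < |x| := hx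
      have : r ^ 2 ≤ x ^ 2 := by
        rw [← sq_abs x]; exact pow_le_pow_left₀ hr.le hx'.le 2
      change 1 / 2 ≤ x ^ 2 / (x ^ 2 + r ^ 2)
      rw [div_le_div_iff₀ two_pos (by positivity)]
      linarith
    · rw [Set.indicator_of_notMem hx]; positivity
  rw [← ofReal_measureReal]
  exact ENNReal.ofReal_le_ofReal (by linarith)

/-- The smoothing of a measure by the Cauchy kernel is determined by the Stieltjes transform. -/
lemma lintegral_cauchyPDF_eq (N : ProbabilityMeasure ℝ) {η : ℝ≥0} (hη : η ≠ 0) (x : ℝ) :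
    ∫⁻ t, cauchyPDF t η x ∂(N : Measure ℝ)
      = ENNReal.ofReal (Real.pi⁻¹ * (stieltjesTransform N ⟨x, η⟩).im) := by
  have hz : (⟨x, η⟩ : ℂ).im ≠ 0 := by simpa using hη
  have hint := integrable_inv_ofReal_sub (N : Measure ℝ) hz
  have e : ∀ t : ℝ, cauchyPDFReal t η x = Real.pi⁻¹ * (((t : ℂ) - ⟨x, η⟩)⁻¹).im := fun t => by
    rw [im_inv_ofReal_sub, cauchyPDFReal_def, Complex.normSq_apply]
    simp only [Complex.sub_re, Complex.sub_im, Complex.ofReal_re, Complex.ofReal_im]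
    rw [mul_assoc, div_eq_mul_inv]
    congr 3
    ring
  have e2 : (stieltjesTransform N ⟨x, η⟩).im
      = ∫ t : ℝ, (((t : ℂ) - ⟨x, η⟩)⁻¹).im ∂(N : Measure ℝ) := by
    rw [stieltjesTransform_eq]
    exact (integral_im hint).symm
  have hint' : Integrable (fun t : ℝ => Real.pi⁻¹ * (((t : ℂ) - ⟨x, η⟩)⁻¹).im) (N : Measure ℝ) :=
    hint.im.const_mul _
  rw [e2, ← integral_const_mul, ofReal_integral_eq_lintegral_ofReal hint']
  · simp only [cauchyPDF_def, e]
  · exact ae_of_all _ fun t => by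
      change 0 ≤ Real.pi⁻¹ * (((t : ℂ) - ⟨x, η⟩)⁻¹).im
      rw [← e]; exact (cauchyPDF_pos t hη x).le

/-- Substitution `x = t + η u`: the scale `η` moves from the kernel into the test function, where it
can be sent to zero. -/
lemma lintegral_mul_cauchyPDF (φ : ℝ → ℝ≥0∞) (t : ℝ) {η : ℝ≥0} (hη : η ≠ 0) :
    ∫⁻ x, φ x * cauchyPDF t η x = ∫⁻ u, φ (t + η * u) * cauchyPDF 0 1 u := by
  have hη' : (η : ℝ) ≠ 0 := by exact_mod_cast hη
  rw [← lintegral_add_left_eq_self (fun x => φ x * cauchyPDF t η x) t]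
  conv_lhs => rw [← Real.smul_map_volume_mul_left hη']
  have hmap := fun f : ℝ → ℝ≥0∞ =>
    (Homeomorph.mulLeft₀ (η : ℝ) hη').measurableEmbedding.lintegral_map (μ := volume) f
  simp only [Homeomorph.coe_mulLeft₀] at hmap
  rw [lintegral_smul_measure, smul_eq_mul, hmap, ← lintegral_const_mul' _ _ ENNReal.ofReal_ne_top]
  refine lintegral_congr fun u => ?_
  rw [mul_left_comm, cauchyPDF_def, cauchyPDF_def, ← ENNReal.ofReal_mul (abs_nonneg _)]
  congr 2
  rw [abs_of_nonneg η.coe_nonneg, cauchyPDFReal_def', cauchyPDFReal_def', add_sub_cancel_left,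
    mul_div_cancel_left₀ _ hη', mul_comm Real.pi⁻¹, ← mul_assoc, ← mul_assoc, NNReal.coe_inv,
    mul_inv_cancel₀ hη']
  simp

/-- A probability measure on the line is determined by its Stieltjes transform on the upper
half-plane. -/
theorem ProbabilityMeasure.ext_of_stieltjesTransform {μ ν : ProbabilityMeasure ℝ}
    (h : ∀ z : ℂ, 0 < z.im → stieltjesTransform μ z = stieltjesTransform ν z) : μ = ν := by
  -- Integrating `φ` against the smoothed density is averaging `φ (X + η C)`, with `X` of law `N`
  -- and `C` an independent standard Cauchy variable. The left side depends on `N` only through its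
  -- Stieltjes transform.
  have hsm : ∀ (N : ProbabilityMeasure ℝ) (φ : ℝ →ᵇ ℝ≥0) {η : ℝ≥0}, η ≠ 0 →
      ∫⁻ x, φ x * ENNReal.ofReal (Real.pi⁻¹ * (stieltjesTransform N ⟨x, η⟩).im)
        = ∫⁻ p, φ (p.1 + η * p.2) ∂((N : Measure ℝ).prod (cauchyMeasure 0 1)) := by
    intro N φ η hη
    have hφ : Measurable fun x => (φ x : ℝ≥0∞) := by
      have := φ.continuous.measurable
      fun_prop
    rw [lintegral_prod]
    swap
    · exact (hφ.comp (by fun_prop)).aemeasurable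
    simp only [← lintegral_cauchyPDF_eq N hη]
    have hmeas : Measurable (Function.uncurry fun x t => (φ x : ℝ≥0∞) * cauchyPDF t η x) := by
      have : Measurable fun p : ℝ × ℝ => cauchyPDF p.2 η p.1 := by
        unfold cauchyPDF cauchyPDFReal; fun_prop
      exact (hφ.comp measurable_fst).mul this
    calc ∫⁻ x, (φ x * ∫⁻ t, cauchyPDF t η x ∂(N : Measure ℝ))
        = ∫⁻ x, (∫⁻ t, φ x * cauchyPDF t η x ∂(N : Measure ℝ)) :=
          lintegral_congr fun x => (lintegral_const_mul' _ _ ENNReal.coe_ne_top).symm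
      _ = ∫⁻ t, (∫⁻ x, φ x * cauchyPDF t η x) ∂(N : Measure ℝ) :=
          lintegral_lintegral_swap hmeas.aemeasurable
      _ = _ := by
          refine lintegral_congr fun t => ?_
          rw [lintegral_mul_cauchyPDF (fun x => φ x) t hη,
            cauchyMeasure_of_scale_ne_zero 0 one_ne_zero,
            lintegral_withDensity_eq_lintegral_mul _ (measurable_cauchyPDF 0 1)
              (g := fun u => (φ (t + η * u) : ℝ≥0∞)) (hφ.comp (by fun_prop))]
          exact lintegral_congr fun u => mul_comm _ _
  -- Letting `η = 1 / (n + 1) → 0` removes the smoothing by dominated convergence.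
  have hlim : ∀ (N : ProbabilityMeasure ℝ) (φ : ℝ →ᵇ ℝ≥0),
      Tendsto (fun n : ℕ => ∫⁻ p, φ (p.1 + ((1 / ((n : ℝ≥0) + 1) : ℝ≥0) : ℝ) * p.2)
        ∂((N : Measure ℝ).prod (cauchyMeasure 0 1))) atTop (𝓝 (∫⁻ x, φ x ∂(N : Measure ℝ))) := by
    intro N φ
    have hφ : Measurable fun x => (φ x : ℝ≥0∞) := by
      have := φ.continuous.measurable
      fun_prop
    have e : ∫⁻ x, φ x ∂(N : Measure ℝ)
        = ∫⁻ p, φ p.1 ∂((N : Measure ℝ).prod (cauchyMeasure 0 1)) := by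
      rw [lintegral_prod (fun p : ℝ × ℝ => (φ p.1 : ℝ≥0∞)) (hφ.comp measurable_fst).aemeasurable]
      simp
    rw [e]
    refine tendsto_lintegral_of_dominated_convergence (fun _ => nndist φ 0)
      (fun n => hφ.comp (by fun_prop)) (fun n => ae_of_all _ fun p => ?_) (by simp)
      (ae_of_all _ fun p => ?_)
    · exact ENNReal.coe_le_coe.2 (BoundedContinuousFunction.NNReal.upper_bound φ _)
    · refine (ENNReal.continuous_coe.tendsto _).comp ((φ.continuous.tendsto _).comp ?_)
      have h1 : Tendsto (fun n : ℕ => 1 / ((n : ℝ) + 1)) atTop (𝓝 0) :=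
        tendsto_one_div_add_atTop_nhds_zero_nat
      simpa using (h1.mul_const p.2).const_add p.1
  refine Subtype.ext (ext_of_forall_lintegral_eq_of_IsFiniteMeasure (μ := (μ : Measure ℝ))
    (ν := (ν : Measure ℝ)) fun φ => ?_)
  refine tendsto_nhds_unique (hlim μ φ) ((hlim ν φ).congr fun n => ?_)
  rw [← hsm ν φ (by positivity), ← hsm μ φ (by positivity)]
  refine lintegral_congr fun x => ?_
  rw [h _ (by simp; positivity)]

end Stieltjes

/-! ### The functional equation -/

section FunctionalEquation

lemma continuous_inv_one_add {w : ℂ} (hw : 0 < w.im) :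
    Continuous fun t : ℝ => (1 + (t : ℂ) * w)⁻¹ :=
  (by fun_prop : Continuous fun t : ℝ => 1 + (t : ℂ) * w).inv₀
    fun t => one_add_ofReal_mul_ne_zero t hw

/-- The function `t ↦ (1 + t w)⁻¹` as a bounded continuous function. -/
def invOneAddBCF {w : ℂ} (hw : 0 < w.im) : ℝ →ᵇ ℂ :=
  BoundedContinuousFunction.ofNormedAddCommGroup (fun t : ℝ => (1 + (t : ℂ) * w)⁻¹)
    (continuous_inv_one_add hw) (‖w‖ / w.im) fun t => norm_inv_one_add_le t hw

lemma integrable_inv_one_add (σ : Measure ℝ) [IsFiniteMeasure σ] {w : ℂ} (hw : 0 < w.im) :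
    Integrable (fun t : ℝ => (1 + (t : ℂ) * w)⁻¹) σ :=
  (invOneAddBCF hw).integrable σ

/-- `|Im (1 + t w)| = |t| Im w` absorbs the factor `t`. -/
lemma norm_mul_inv_one_add_le (t : ℝ) {w : ℂ} (hw : 0 < w.im) :
    ‖(t : ℂ) * (1 + (t : ℂ) * w)⁻¹‖ ≤ w.im⁻¹ := by
  have h0 := norm_pos_iff.2 (one_add_ofReal_mul_ne_zero t hw)
  rw [norm_mul, norm_inv, Complex.norm_real, ← div_eq_mul_inv, div_le_iff₀ h0,
    inv_mul_eq_div, le_div_iff₀ hw]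
  calc ‖t‖ * w.im = |(1 + (t : ℂ) * w).im| := by simp [abs_mul, abs_of_pos hw]
    _ ≤ _ := Complex.abs_im_le_norm _

lemma inv_one_add_sub (t : ℝ) {w s : ℂ} (hw : 0 < w.im) (hs : 0 < s.im) :
    (1 + (t : ℂ) * w)⁻¹ - (1 + (t : ℂ) * s)⁻¹
      = (s - w) * ((t : ℂ) * (1 + (t : ℂ) * w)⁻¹ * (1 + (t : ℂ) * s)⁻¹) := by
  have h1 := one_add_ofReal_mul_ne_zero t hw
  have h2 := one_add_ofReal_mul_ne_zero t hs
  field_simp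
  ring

/-- Lipschitz dependence on `w`, uniform in `t`, so that no moment of the weights enters. -/
lemma norm_inv_one_add_sub_le (t : ℝ) {w s : ℂ} (hw : 0 < w.im) (hs : 0 < s.im) :
    ‖(1 + (t : ℂ) * w)⁻¹ - (1 + (t : ℂ) * s)⁻¹‖ ≤ ‖s - w‖ * (w.im⁻¹ * (‖s‖ / s.im)) := by
  rw [inv_one_add_sub t hw hs, norm_mul, norm_mul]
  gcongr
  · exact norm_mul_inv_one_add_le t hw
  · exact norm_inv_one_add_le t hs

lemma tendsto_integral_inv_one_add {ι : Type*} {l : Filter ι} (σ : ProbabilityMeasure ℝ)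
    {w : ι → ℂ} {s : ℂ} (hs : 0 < s.im) (hw : Tendsto w l (𝓝 s)) :
    Tendsto (fun j => ∫ t : ℝ, (1 + (t : ℂ) * w j)⁻¹ ∂(σ : Measure ℝ)) l
      (𝓝 (∫ t : ℝ, (1 + (t : ℂ) * s)⁻¹ ∂(σ : Measure ℝ))) := by
  rw [tendsto_iff_norm_sub_tendsto_zero]
  have him : Tendsto (fun j => (w j).im) l (𝓝 s.im) := (Complex.continuous_im.tendsto s).comp hw
  have hb : Tendsto (fun j => ‖s - w j‖ * ((w j).im⁻¹ * (‖s‖ / s.im))) l (𝓝 0) := by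
    have h1 : Tendsto (fun j => ‖s - w j‖) l (𝓝 0) := by
      simpa using (hw.const_sub s).norm
    simpa using h1.mul ((him.inv₀ hs.ne').mul_const (‖s‖ / s.im))
  refine squeeze_zero' (Eventually.of_forall fun _ => norm_nonneg _) ?_ hb
  filter_upwards [him.eventually_const_lt hs] with j hj
  rw [← integral_sub (integrable_inv_one_add _ hj) (integrable_inv_one_add _ hs)]
  refine (norm_integral_le_of_norm_le_const
    (ae_of_all _ fun t => norm_inv_one_add_sub_le t hj hs)).trans_eq ?_
  simp

/-- Uniqueness, at a point of the upper half-plane, of the solution of the functional equation. -/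
lemma mpEquation_unique {c : ℝ} (hc : 0 < c) (σ : ProbabilityMeasure ℝ) {z f g : ℂ}
    (hz : 0 < z.im) (hf : 0 < f.im) (hg : 0 < g.im)
    (ef : z * f = c - 1 - c * ∫ t : ℝ, (1 + (t : ℂ) * f)⁻¹ ∂(σ : Measure ℝ))
    (eg : z * g = c - 1 - c * ∫ t : ℝ, (1 + (t : ℂ) * g)⁻¹ ∂(σ : Measure ℝ)) : f = g := by
  have hmul : ∀ {w : ℂ}, 0 < w.im →
      Integrable (fun t : ℝ => (t : ℂ) * (1 + (t : ℂ) * w)⁻¹) (σ : Measure ℝ) := fun {w} hw =>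
    Integrable.of_bound ((Complex.continuous_ofReal.mul
      (continuous_inv_one_add hw)).aestronglyMeasurable) _
      (ae_of_all _ fun t => norm_mul_inv_one_add_le t hw)
  have hsq : ∀ {w : ℂ}, 0 < w.im →
      Integrable (fun t : ℝ => ‖(t : ℂ) * (1 + (t : ℂ) * w)⁻¹‖ ^ 2) (σ : Measure ℝ) := fun {w} hw =>
    Integrable.of_bound (((Complex.continuous_ofReal.mul
      (continuous_inv_one_add hw)).norm.pow 2).aestronglyMeasurable) (w.im⁻¹ ^ 2)
      (ae_of_all _ fun t => by
        rw [norm_pow, norm_norm]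
        exact pow_le_pow_left₀ (norm_nonneg _) (norm_mul_inv_one_add_le t hw) 2)
  have hne : ∀ {w : ℂ}, 0 < w.im → w ≠ 0 := fun hw h => by simp [h] at hw
  -- The equation is divided by `w`, using `(1 + t w)⁻¹ = 1 - w t (1 + t w)⁻¹`.
  have key : ∀ {w : ℂ}, 0 < w.im →
      z * w = c - 1 - c * ∫ t : ℝ, (1 + (t : ℂ) * w)⁻¹ ∂(σ : Measure ℝ) →
      z = -w⁻¹ + c * ∫ t : ℝ, (t : ℂ) * (1 + (t : ℂ) * w)⁻¹ ∂(σ : Measure ℝ) := by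
    intro w hw ew
    have h1 : ∫ t : ℝ, (1 + (t : ℂ) * w)⁻¹ ∂(σ : Measure ℝ)
        = 1 - w * ∫ t : ℝ, (t : ℂ) * (1 + (t : ℂ) * w)⁻¹ ∂(σ : Measure ℝ) := by
      rw [← integral_const_mul]
      have h2 : ∫ t : ℝ, ((1 : ℂ) - w * ((t : ℂ) * (1 + (t : ℂ) * w)⁻¹)) ∂(σ : Measure ℝ)
          = 1 - ∫ t : ℝ, w * ((t : ℂ) * (1 + (t : ℂ) * w)⁻¹) ∂(σ : Measure ℝ) := by
        rw [integral_sub (integrable_const _) ((hmul hw).const_mul w)]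
        simp
      rw [← h2]
      refine integral_congr_ae (ae_of_all _ fun t => ?_)
      have := one_add_ofReal_mul_ne_zero t hw
      field_simp
      ring
    rw [h1] at ew
    have hw0 := hne hw
    generalize ∫ t : ℝ, (t : ℂ) * (1 + (t : ℂ) * w)⁻¹ ∂(σ : Measure ℝ) = J at *
    field_simp
    linear_combination ew
  -- Imaginary parts in `key` give `Im z = Im w (|w|⁻² - c ∫ |t / (1 + t w)|²)`; strictness comes
  -- from `Im z > 0`.
  have key2 : ∀ {w : ℂ}, 0 < w.im →
      z * w = c - 1 - c * ∫ t : ℝ, (1 + (t : ℂ) * w)⁻¹ ∂(σ : Measure ℝ) →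
      c * ∫ t : ℝ, ‖(t : ℂ) * (1 + (t : ℂ) * w)⁻¹‖ ^ 2 ∂(σ : Measure ℝ) < (‖w‖ ^ 2)⁻¹ := by
    intro w hw ew
    have h1 := congrArg Complex.im (key hw ew)
    have h2 : (∫ t : ℝ, (t : ℂ) * (1 + (t : ℂ) * w)⁻¹ ∂(σ : Measure ℝ)).im
        = -(w.im * ∫ t : ℝ, ‖(t : ℂ) * (1 + (t : ℂ) * w)⁻¹‖ ^ 2 ∂(σ : Measure ℝ)) := by
      rw [← integral_const_mul, ← integral_neg]
      refine (integral_im (hmul hw)).symm.trans (integral_congr_ae (ae_of_all _ fun t => ?_))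
      change ((t : ℂ) * (1 + (t : ℂ) * w)⁻¹).im = _
      simp only
      rw [Complex.im_ofReal_mul, Complex.inv_im, norm_mul, norm_inv, mul_pow, inv_pow,
        Complex.norm_real, Real.norm_eq_abs, sq_abs, ← Complex.normSq_eq_norm_sq]
      simp
      ring
    rw [Complex.add_im, Complex.neg_im, Complex.inv_im, Complex.im_ofReal_mul, h2,
      Complex.normSq_eq_norm_sq] at h1
    have h3 : z.im = w.im * ((‖w‖ ^ 2)⁻¹
        - c * ∫ t : ℝ, ‖(t : ℂ) * (1 + (t : ℂ) * w)⁻¹‖ ^ 2 ∂(σ : Measure ℝ)) := by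
      rw [h1]; ring
    rw [h3] at hz
    have := (mul_pos_iff_of_pos_left hw).1 hz
    linarith
  have hfg := (key hf ef).symm.trans (key hg eg)
  have kf := key2 hf ef
  have kg := key2 hg eg
  by_contra hne'
  have nf : 0 < ‖f‖ := norm_pos_iff.2 (hne hf)
  have ng : 0 < ‖g‖ := norm_pos_iff.2 (hne hg)
  set P := ∫ t : ℝ, ((t : ℂ) * (1 + (t : ℂ) * f)⁻¹) * ((t : ℂ) * (1 + (t : ℂ) * g)⁻¹)
    ∂(σ : Measure ℝ) with hP
  have hdiff : (∫ t : ℝ, (t : ℂ) * (1 + (t : ℂ) * f)⁻¹ ∂(σ : Measure ℝ))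
      - ∫ t : ℝ, (t : ℂ) * (1 + (t : ℂ) * g)⁻¹ ∂(σ : Measure ℝ) = (g - f) * P := by
    rw [← integral_sub (hmul hf) (hmul hg), hP, ← integral_const_mul]
    refine integral_congr_ae (ae_of_all _ fun t => ?_)
    have := inv_one_add_sub t hf hg
    simp only
    linear_combination (t : ℂ) * this
  -- Subtracting the two forms of the equation and cancelling `g - f`, which is nonzero by
  -- assumption.
  have hPeq : (c : ℂ) * P = f⁻¹ * g⁻¹ := by
    have h0 : g - f ≠ 0 := sub_ne_zero.2 (Ne.symm hne')
    refine mul_left_cancel₀ h0 ?_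
    have e1 : (g - f) * (f⁻¹ * g⁻¹) = f⁻¹ - g⁻¹ := by
      have := hne hf
      have := hne hg
      field_simp
    rw [e1]
    linear_combination (-(c : ℂ)) * hdiff + hfg
  have hPn : c * ‖P‖ = ‖f‖⁻¹ * ‖g‖⁻¹ := by
    have := congrArg norm hPeq
    rwa [norm_mul, norm_mul, norm_inv, norm_inv, Complex.norm_real, Real.norm_of_nonneg hc.le]
      at this
  -- AM–GM with weights `|f| / |g|` and `|g| / |f|`: by `key2` each weighted integral times `c` is
  -- strictly below `1 / (|f| |g|)`, contradicting `hPn`.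
  have hPle : ‖P‖ ≤ (‖f‖ / ‖g‖ * (∫ t : ℝ, ‖(t : ℂ) * (1 + (t : ℂ) * f)⁻¹‖ ^ 2 ∂(σ : Measure ℝ))
      + ‖g‖ / ‖f‖ * ∫ t : ℝ, ‖(t : ℂ) * (1 + (t : ℂ) * g)⁻¹‖ ^ 2 ∂(σ : Measure ℝ)) / 2 := by
    rw [← integral_const_mul, ← integral_const_mul,
      ← integral_add ((hsq hf).const_mul _) ((hsq hg).const_mul _), ← integral_div]
    refine norm_integral_le_of_norm_le
      ((((hsq hf).const_mul _).add ((hsq hg).const_mul _)).div_const 2) (ae_of_all _ fun t => ?_)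
    rw [norm_mul]
    generalize ‖(t : ℂ) * (1 + (t : ℂ) * f)⁻¹‖ = a
    generalize ‖(t : ℂ) * (1 + (t : ℂ) * g)⁻¹‖ = b
    have e1 : (‖f‖ / ‖g‖ * a ^ 2 + ‖g‖ / ‖f‖ * b ^ 2) / 2 - a * b
        = (‖f‖ * a - ‖g‖ * b) ^ 2 / (2 * ‖f‖ * ‖g‖) := by
      field_simp
      ring
    have e2 : 0 ≤ (‖f‖ * a - ‖g‖ * b) ^ 2 / (2 * ‖f‖ * ‖g‖) := by positivity
    linarith
  have h1 := mul_lt_mul_of_pos_left kf (div_pos nf ng)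
  have h2 := mul_lt_mul_of_pos_left kg (div_pos ng nf)
  have h3 := mul_le_mul_of_nonneg_left hPle hc.le
  have e1 : ‖f‖ / ‖g‖ * (‖f‖ ^ 2)⁻¹ = ‖f‖⁻¹ * ‖g‖⁻¹ := by field_simp
  have e2 : ‖g‖ / ‖f‖ * (‖g‖ ^ 2)⁻¹ = ‖f‖⁻¹ * ‖g‖⁻¹ := by field_simp
  rw [e1] at h1
  rw [e2] at h2
  rw [hPn] at h3
  linarith

/-- A value with non-negative imaginary part solving the functional equation at a point of the
upper half-plane has positive imaginary part. -/
lemma mpEquation_im_pos {c : ℝ} (σ : ProbabilityMeasure ℝ) {z f : ℂ}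
    (hz : 0 < z.im) (hf : 0 ≤ f.im)
    (ef : z * f = c - 1 - c * ∫ t : ℝ, (1 + (t : ℂ) * f)⁻¹ ∂(σ : Measure ℝ)) : 0 < f.im := by
  rcases hf.lt_or_eq with h | h
  · exact h
  exfalso
  obtain ⟨r, rfl⟩ : ∃ r : ℝ, f = r := ⟨f.re, Complex.ext rfl (by simp [← h])⟩
  -- This holds even if the integrand is not integrable, both integrals then being `0` by
  -- convention.
  have e : ∫ t : ℝ, (1 + (t : ℂ) * (r : ℂ))⁻¹ ∂(σ : Measure ℝ)
      = ((∫ t : ℝ, (1 + t * r)⁻¹ ∂(σ : Measure ℝ) : ℝ) : ℂ) := by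
    rw [← integral_complex_ofReal]
    push_cast; rfl
  have h1 := congrArg Complex.im ef
  rw [e] at h1
  simp at h1
  -- The right side of the equation is real, so `z r` is real and `r = 0`; the equation then reads
  -- `0 = -1`.
  rcases h1 with h1 | h1
  · exact hz.ne' h1
  · subst h1
    simp at ef

/-- The Stieltjes transform of a probability measure solving the functional equation in the upper
half-plane is the unique solution of it. -/
lemma isMPSolution_stieltjesTransform {c : ℝ} (σ N : ProbabilityMeasure ℝ)
    (h : ∀ z : ℂ, 0 < z.im → z * stieltjesTransform N z
      = c - 1 - c * ∫ t : ℝ, (1 + (t : ℂ) * stieltjesTransform N z)⁻¹ ∂(σ : Measure ℝ)) :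
    IsMPSolution c σ (stieltjesTransform N) := by
  -- The lower half-plane is reduced to the upper one by conjugation, under which the equation is
  -- invariant.
  have hconj : ∀ z : ℂ, z.im < 0 → stieltjesTransform N z
      = starRingEnd ℂ (stieltjesTransform N (starRingEnd ℂ z)) := fun z _ => by
    rw [stieltjesTransform_conj, Complex.conj_conj]
  have hzc : ∀ z : ℂ, z.im < 0 → 0 < (starRingEnd ℂ z).im := fun z hz => by simpa using hz
  have hfun : ∀ (w : ℂ) (t : ℝ),
      (1 + (t : ℂ) * starRingEnd ℂ w)⁻¹ = starRingEnd ℂ ((1 + (t : ℂ) * w)⁻¹) := fun w t => by simp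
  refine ⟨analyticOnNhd_stieltjesTransform N, fun z hz => ?_, fun z hz => ?_, fun z hz => ?_,
    fun z hz => ?_⟩
  · rcases hz.lt_or_gt with hz | hz
    · rw [hconj z hz, Complex.conj_im]
      nlinarith [im_stieltjesTransform_pos N (hzc z hz)]
    · exact mul_nonneg (im_stieltjesTransform_pos N hz).le hz.le
  · refine ae_of_all _ fun t => ?_
    rcases hz.lt_or_gt with hz | hz
    · have := one_add_ofReal_mul_ne_zero t (im_stieltjesTransform_pos N (hzc z hz))
      rw [hconj z hz]
      intro h0
      apply this
      have := congrArg (starRingEnd ℂ) h0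
      simpa using this
    · exact one_add_ofReal_mul_ne_zero t (im_stieltjesTransform_pos N hz)
  · rcases hz.lt_or_gt with hz | hz
    · have := integrable_inv_one_add (σ : Measure ℝ) (im_stieltjesTransform_pos N (hzc z hz))
      rw [hconj z hz]
      simp only [hfun]
      exact (Complex.conjLIE.toContinuousLinearEquiv.toContinuousLinearMap).integrable_comp this
    · exact integrable_inv_one_add _ (im_stieltjesTransform_pos N hz)
  · rcases hz.lt_or_gt with hz | hz
    · have h1 := congrArg (starRingEnd ℂ) (h _ (hzc z hz))
      rw [hconj z hz]
      simp only [hfun, integral_conj]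
      simpa using h1
    · exact h z hz

/-- Membership in the class gives only a weak sign for the imaginary part; `mpEquation_im_pos` makes
it strict, after a conjugation when `Im z < 0`. -/
lemma IsMPSolution.eq_of_im_ne_zero {c : ℝ} (hc : 0 < c) {σ : ProbabilityMeasure ℝ} {f g : ℂ → ℂ}
    (hf : IsMPSolution c σ f) (hg : IsMPSolution c σ g) {z : ℂ} (hz : z.im ≠ 0) : f z = g z := by
  rcases hz.lt_or_gt with hz' | hz'
  · have hzc : 0 < (starRingEnd ℂ z).im := by simpa using hz'
    have key : ∀ {f : ℂ → ℂ}, IsMPSolution c σ f → 0 ≤ (starRingEnd ℂ (f z)).im ∧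
        starRingEnd ℂ z * starRingEnd ℂ (f z) = c - 1 - c * ∫ t : ℝ,
          (1 + (t : ℂ) * starRingEnd ℂ (f z))⁻¹ ∂(σ : Measure ℝ) := by
      intro f hf
      refine ⟨?_, ?_⟩
      · have := hf.im_mul_im_nonneg z hz
        rw [Complex.conj_im]
        nlinarith
      · have h1 := congrArg (starRingEnd ℂ) (hf.equation z hz)
        have hfun : ∀ (w : ℂ) (t : ℝ), (1 + (t : ℂ) * starRingEnd ℂ w)⁻¹
            = starRingEnd ℂ ((1 + (t : ℂ) * w)⁻¹) := fun w t => by simp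
        simp only [hfun, integral_conj]
        simpa using h1
    obtain ⟨f1, f2⟩ := key hf
    obtain ⟨g1, g2⟩ := key hg
    exact (starRingEnd ℂ).injective (mpEquation_unique hc σ hzc (mpEquation_im_pos σ hzc f1 f2)
      (mpEquation_im_pos σ hzc g1 g2) f2 g2)
  · have key : ∀ {f : ℂ → ℂ}, IsMPSolution c σ f → 0 < (f z).im := fun {f} hf =>
      mpEquation_im_pos σ hz' (nonneg_of_mul_nonneg_left (hf.im_mul_im_nonneg z hz) hz')
        (hf.equation z hz)
    exact mpEquation_unique hc σ hz' (key hf) (key hg) (hf.equation z hz) (hg.equation z hz)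

end FunctionalEquation
end

noncomputable section

/-! ### Limits of spectral measures of weighted Gram matrices -/

section Limit

/-- Truncation of a real number to the interval `[-T, T]`. -/
def clip (T x : ℝ) : ℝ := max (-T) (min T x)

lemma abs_clip_le {T : ℝ} (hT : 0 ≤ T) (x : ℝ) : |clip T x| ≤ T :=
  abs_le.2 ⟨le_max_left _ _, max_le (by linarith) (min_le_left _ _)⟩

lemma clip_eq_self {T x : ℝ} (h : |x| ≤ T) : clip T x = x := by
  rw [abs_le] at h
  rw [clip, min_eq_right h.2, max_eq_right h.1]

/-- The number of weights which are changed by the truncation at `T`. -/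
def numClipped {A : Type*} [Fintype A] (T : ℝ) (τ : A → ℝ) : ℕ :=
  (Finset.univ.filter fun α => τ α ≠ clip T (τ α)).card

/-- The bound uses a fixed level `L`, so the truncation level may grow with the index. -/
lemma numClipped_anti {A : Type*} [Fintype A] {L T : ℝ} (hLT : L ≤ T) (τ : A → ℝ) :
    numClipped T τ ≤ (Finset.univ.filter fun α => L < |τ α|).card := by
  refine Finset.card_le_card fun α => ?_
  simp only [Finset.mem_filter, Finset.mem_univ, true_and]
  intro h
  by_contra h'
  exact h (clip_eq_self ((not_lt.1 h').trans hLT)).symm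

/-- The function `x ↦ min 1 (|x| / L)`. -/
def tailBCF (L : ℝ) : ℝ →ᵇ ℝ :=
  BoundedContinuousFunction.ofNormedAddCommGroup (fun x : ℝ => min 1 (|x| / |L|))
    (by fun_prop) 1 fun x => by
      rw [Real.norm_of_nonneg (le_min zero_le_one (by positivity))]
      exact min_le_left _ _

lemma tailBCF_apply (L x : ℝ) : tailBCF L x = min 1 (|x| / |L|) := rfl

lemma tendsto_integral_tailBCF (σ : ProbabilityMeasure ℝ) :
    Tendsto (fun L => ∫ x, tailBCF L x ∂(σ : Measure ℝ)) atTop (𝓝 0) := by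
  have h0 : (0 : ℝ) = ∫ _ : ℝ, (0 : ℝ) ∂(σ : Measure ℝ) := by simp
  rw [h0]
  refine tendsto_integral_filter_of_dominated_convergence (fun _ => 1)
    (Eventually.of_forall fun L => (tailBCF L).continuous.aestronglyMeasurable)
    (Eventually.of_forall fun L => ae_of_all _ fun x => ?_) (integrable_const _)
    (ae_of_all _ fun x => ?_)
  · rw [tailBCF_apply, Real.norm_of_nonneg (le_min zero_le_one (by positivity))]
    exact min_le_left _ _
  · have h1 : Tendsto (fun L : ℝ => |x| / |L|) atTop (𝓝 0) :=
      tendsto_const_nhds.div_atTop tendsto_abs_atTop_atTop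
    simpa [tailBCF_apply] using (tendsto_const_nhds (x := (1 : ℝ))).min h1

lemma card_mul_integral_ncm {A E : Type*} [Fintype A] [NormedAddCommGroup E] [NormedSpace ℝ E]
    [CompleteSpace E] (τ : A → ℝ) (f : ℝ → E) :
    (Fintype.card A : ℝ) • ∫ x, f x ∂(normalizedCountingMeasure τ : Measure ℝ) = ∑ α, f (τ α) := by
  rw [integral_normalizedCountingMeasure, smul_smul]
  rcases isEmpty_or_nonempty A with h | h
  · simp
  · rw [mul_inv_cancel₀ (by simp), one_smul]

/-! ### Proportion of large weights along a weakly convergent sequence -/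

section Sequence

variable {A : ℕ → Type*} [∀ j, Fintype (A j)] {τ : ∀ j, A j → ℝ} {N : ℕ → ℝ} {c : ℝ}
  {σ : ProbabilityMeasure ℝ}

/-- `tailBCF L` is a continuous majorant of the indicator of `|x| > L`, so weak convergence applies
to it, and its integral vanishes as `L → ∞`. -/
lemma exists_card_large_le (hN : ∀ j, 0 ≤ N j)
    (hc : Tendsto (fun j => (Fintype.card (A j) : ℝ) / N j) atTop (𝓝 c))
    (hσ : Tendsto (fun j => normalizedCountingMeasure (τ j)) atTop (𝓝 σ.toFiniteMeasure))
    {ε : ℝ} (hε : 0 < ε) :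
    ∃ L > 0, ∀ᶠ j in atTop, ((Finset.univ.filter fun α => L < |τ j α|).card : ℝ) / N j ≤ ε := by
  have h1 : Tendsto (fun L => c * ∫ x, tailBCF L x ∂(σ : Measure ℝ)) atTop (𝓝 0) := by
    simpa using (tendsto_integral_tailBCF σ).const_mul c
  obtain ⟨L, hL, hL0⟩ := ((h1.eventually_lt_const hε).and (eventually_gt_atTop 0)).exists
  refine ⟨L, hL0, ?_⟩
  have h2 := hc.mul (FiniteMeasure.tendsto_iff_forall_integral_tendsto.1 hσ (tailBCF L))
  filter_upwards [h2.eventually_lt_const hL] with j hj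
  refine le_trans ?_ hj.le
  rw [div_mul_eq_mul_div, ← smul_eq_mul (Fintype.card (A j) : ℝ), card_mul_integral_ncm]
  refine div_le_div_of_nonneg_right ?_ (hN j)
  rw [Finset.card_filter, Nat.cast_sum]
  refine Finset.sum_le_sum fun α _ => ?_
  rw [tailBCF_apply]
  split_ifs with h
  · rw [abs_of_pos hL0, Nat.cast_one]
    exact le_min le_rfl ((one_le_div hL0).2 h.le)
  · rw [Nat.cast_zero]
    exact le_min zero_le_one (by positivity)

lemma tendsto_numClipped_div (hN : ∀ j, 0 ≤ N j)
    (hc : Tendsto (fun j => (Fintype.card (A j) : ℝ) / N j) atTop (𝓝 c))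
    (hσ : Tendsto (fun j => normalizedCountingMeasure (τ j)) atTop (𝓝 σ.toFiniteMeasure))
    {T : ℕ → ℝ} (hT : Tendsto T atTop atTop) :
    Tendsto (fun j => (numClipped (T j) (τ j) : ℝ) / N j) atTop (𝓝 0) := by
  refine tendsto_order.2 ⟨fun a ha => Eventually.of_forall fun j =>
    ha.trans_le (div_nonneg (Nat.cast_nonneg _) (hN j)), fun a ha => ?_⟩
  obtain ⟨L, -, hL⟩ := exists_card_large_le hN hc hσ (half_pos ha)
  filter_upwards [hL, hT.eventually_ge_atTop L] with j h1 h2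
  refine lt_of_le_of_lt ?_ (half_lt_self ha)
  refine le_trans (div_le_div_of_nonneg_right ?_ (hN j)) h1
  exact_mod_cast numClipped_anti h2 (τ j)

end Sequence

/-! ### Spectral measures and truncation of the weights -/

section Spectral

open Matrix

variable {I A : Type*} [Fintype I] [DecidableEq I] [Fintype A]

lemma isProbabilityMeasure_ncm {I : Type*} [Fintype I] [Nonempty I] (x : I → ℝ) :
    IsProbabilityMeasure (normalizedCountingMeasure x : Measure ℝ) := by
  constructor
  have h := integral_normalizedCountingMeasure x (fun _ => (1 : ℝ))
  simp only [integral_const, smul_eq_mul, mul_one, Finset.sum_const, Finset.card_univ,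
    nsmul_eq_mul] at h
  rw [inv_mul_cancel₀ (by simp), measureReal_def] at h
  rwa [ENNReal.toReal_eq_one_iff] at h

/-- The normalized counting measure of the eigenvalues of a weighted Gram matrix. -/
def spectralMeasure [Nonempty I] (τ : A → ℝ) (Y : A → I → ℝ) : ProbabilityMeasure ℝ :=
  ⟨normalizedCountingMeasure (weightedGram_isHermitian τ Y).eigenvalues,
    isProbabilityMeasure_ncm _⟩

lemma stieltjesTransform_spectralMeasure [Nonempty I] (τ : A → ℝ) (Y : A → I → ℝ) {z : ℂ}
    (hz : 0 < z.im) : stieltjesTransform (spectralMeasure τ Y) z = gramTrace τ Y z := by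
  rw [stieltjesTransform_eq, gramTrace_eq_integral τ Y hz]
  rfl

lemma gramTrace_im_pos [Nonempty I] (τ : A → ℝ) (Y : A → I → ℝ) {z : ℂ} (hz : 0 < z.im) :
    0 < (gramTrace τ Y z).im := by
  rw [← stieltjesTransform_spectralMeasure τ Y hz]
  exact im_stieltjesTransform_pos _ hz

lemma norm_gramTrace_sub_clip_le [DecidableEq A] (T : ℝ) (τ : A → ℝ) (Y : A → I → ℝ) {z : ℂ}
    (hz : 0 < z.im) :
    ‖gramTrace τ Y z - gramTrace (fun α => clip T (τ α)) Y z‖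
      ≤ numClipped T τ / Fintype.card I * z.im⁻¹ := by
  rw [gramTrace, gramTrace, ← sub_div, norm_div, Complex.norm_natCast, div_mul_eq_mul_div]
  exact div_le_div_of_nonneg_right (norm_trace_gramResolvent_sub_le _ _ Y hz) (Nat.cast_nonneg _)

/-- The error in the approximate functional equation. -/
def equationError [DecidableEq A] (τ : A → ℝ) (Y : A → I → ℝ) (z : ℂ) (T s : ℝ) : ℝ :=
  (Fintype.card I : ℝ)⁻¹ *
    ∑ α, T * (s⁻¹ * (quadDeviation τ Y z α + (z.im⁻¹ / Fintype.card I) ^ 2)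
      + s * (1 + (T * z.im⁻¹ * ∑ i, Y α i ^ 2) ^ 2))

/-- Evaluated at `z = i r`. The truncation error of `g` carries `(Im z)⁻¹ = r⁻¹`, which cancels `|z|
= r`; the truncated part decays like `L / r`. -/
lemma spectralMeasure_norm_gt_le [DecidableEq A] [Nonempty I] (τ : A → ℝ) (Y : A → I → ℝ) {r L : ℝ}
    (hr : 0 < r) (hL : 0 ≤ L) :
    (spectralMeasure τ Y : Measure ℝ) {x | r < ‖x‖}
      ≤ ENNReal.ofReal (2 * (L * r⁻¹ * ((Fintype.card I : ℝ)⁻¹ * ∑ α, ∑ i, Y α i ^ 2)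
        + numClipped L τ / Fintype.card I)) := by
  refine (measure_norm_gt_le _ hr).trans (ENNReal.ofReal_le_ofReal ?_)
  have hz : 0 < ((r : ℂ) * Complex.I).im := by simpa using hr
  have hzim : ((r : ℂ) * Complex.I).im = r := by simp
  have hzn : ‖(r : ℂ) * Complex.I‖ = r := by simp [abs_of_pos hr]
  rw [stieltjesTransform_spectralMeasure τ Y hz]
  have h1 := norm_gramTrace_sub_clip_le L τ Y hz
  have h2 := norm_one_add_mul_gramTrace_le (fun α => clip L (τ α)) Y hz
    (fun α => abs_clip_le hL (τ α))
  rw [hzim] at h1 h2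
  set z : ℂ := (r : ℂ) * Complex.I
  have h3 : ‖1 + z * gramTrace τ Y z‖ ≤ ‖1 + z * gramTrace (fun α => clip L (τ α)) Y z‖
      + ‖z * (gramTrace τ Y z - gramTrace (fun α => clip L (τ α)) Y z)‖ := by
    refine le_trans (le_of_eq (congrArg norm ?_)) (norm_add_le _ _)
    ring
  have h4 : ‖z * (gramTrace τ Y z - gramTrace (fun α => clip L (τ α)) Y z)‖
      ≤ numClipped L τ / Fintype.card I := by
    rw [norm_mul, hzn]
    refine (mul_le_mul_of_nonneg_left h1 hr.le).trans_eq ?_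
    field_simp
  linarith

end Spectral

/-! ### Tightness and passage to the limit in the equation -/

section Convergence

variable {I A : ℕ → Type*} [∀ j, Fintype (I j)] [∀ j, DecidableEq (I j)] [∀ j, Nonempty (I j)]
  [∀ j, Fintype (A j)] [∀ j, DecidableEq (A j)] {τ : ∀ j, A j → ℝ} {Y : ∀ j, A j → I j → ℝ}
  {c : ℝ} {σ : ProbabilityMeasure ℝ}

/-- First `L` is fixed so that few weights exceed it, uniformly for large `j`; then `r` is taken
large compared with `L K`. -/
lemma isTightMeasureSet_spectralMeasure
    (hc : Tendsto (fun j => (Fintype.card (A j) : ℝ) / Fintype.card (I j)) atTop (𝓝 c))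
    (hσ : Tendsto (fun j => normalizedCountingMeasure (τ j)) atTop (𝓝 σ.toFiniteMeasure))
    {K : ℝ} (hK : ∀ᶠ j in atTop, (Fintype.card (I j) : ℝ)⁻¹ * ∑ α, ∑ i, Y j α i ^ 2 ≤ K) :
    IsTightMeasureSet (Set.range fun j => (spectralMeasure (τ j) (Y j) : Measure ℝ)) := by
  refine isTightMeasureSet_range_of_tendsto_limsup_measure_norm_gt ?_
  rw [ENNReal.tendsto_nhds_zero]
  intro ε hε
  obtain ⟨e, he0, heε⟩ : ∃ e : ℝ, 0 < e ∧ ENNReal.ofReal (4 * e) ≤ ε := by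
    rcases eq_or_ne ε ⊤ with rfl | hε'
    · exact ⟨1, one_pos, le_top⟩
    · refine ⟨ε.toReal / 4, div_pos (ENNReal.toReal_pos hε.ne' hε') (by norm_num), ?_⟩
      rw [mul_div_cancel₀ _ (by norm_num), ENNReal.ofReal_toReal hε']
  obtain ⟨L, hL0, hL⟩ := exists_card_large_le (fun j => Nat.cast_nonneg _) hc hσ he0
  have hr : Tendsto (fun r : ℝ => L * r⁻¹ * K) atTop (𝓝 0) := by
    simpa using (tendsto_inv_atTop_zero.const_mul L).mul_const K
  filter_upwards [hr.eventually_lt_const he0, eventually_gt_atTop 0] with r hr1 hr0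
  refine (limsup_le_of_le (h := ?_)).trans heε
  filter_upwards [hL, hK] with j hj1 hj2
  refine (spectralMeasure_norm_gt_le (τ j) (Y j) hr0 hL0.le).trans (ENNReal.ofReal_le_ofReal ?_)
  have h1 : (numClipped L (τ j) : ℝ) / Fintype.card (I j) ≤ e := by
    refine le_trans (div_le_div_of_nonneg_right ?_ (Nat.cast_nonneg _)) hj1
    exact_mod_cast numClipped_anti le_rfl (τ j)
  have h2 : L * r⁻¹ * ((Fintype.card (I j) : ℝ)⁻¹ * ∑ α, ∑ i, Y j α i ^ 2) ≤ L * r⁻¹ * K :=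
    mul_le_mul_of_nonneg_left hj2 (by positivity)
  linarith

/-- Weak convergence handles the fixed test function at `s` with the original weights. Replacing `s`
by `w j` costs `O(|s - w j|)` per term, and truncation costs at most `2 |s| / Im s` for each of
`o(N)` altered weights. -/
lemma tendsto_sum_inv_one_add {I A : ℕ → Type*} [∀ j, Fintype (I j)] [∀ j, Fintype (A j)]
    {τ : ∀ j, A j → ℝ}
    (hc : Tendsto (fun j => (Fintype.card (A j) : ℝ) / Fintype.card (I j)) atTop (𝓝 c))
    (hσ : Tendsto (fun j => normalizedCountingMeasure (τ j)) atTop (𝓝 σ.toFiniteMeasure))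
    {T : ℕ → ℝ} (hT : Tendsto T atTop atTop) {w : ℕ → ℂ} {s : ℂ} (hs : 0 < s.im)
    (hw0 : ∀ j, 0 < (w j).im) (hw : Tendsto w atTop (𝓝 s)) :
    Tendsto (fun j => (Fintype.card (I j) : ℂ)⁻¹ *
        ∑ α, (1 - (1 + (clip (T j) (τ j α) : ℂ) * w j)⁻¹)) atTop
      (𝓝 (c * (1 - ∫ t : ℝ, (1 + (t : ℂ) * s)⁻¹ ∂(σ : Measure ℝ)))) := by
  have him : Tendsto (fun j => (w j).im) atTop (𝓝 s.im) := (Complex.continuous_im.tendsto s).comp hw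
  have hmain : Tendsto (fun j => (Fintype.card (I j) : ℂ)⁻¹ *
      ∑ α, (1 - (1 + (τ j α : ℂ) * s)⁻¹)) atTop
      (𝓝 (c * (1 - ∫ t : ℝ, (1 + (t : ℂ) * s)⁻¹ ∂(σ : Measure ℝ)))) := by
    have hcc : Tendsto (fun j => (((Fintype.card (A j) : ℝ) / Fintype.card (I j) : ℝ) : ℂ)) atTop
        (𝓝 (c : ℂ)) := (Complex.continuous_ofReal.tendsto c).comp hc
    have h1 := (FiniteMeasure.tendsto_iff_forall_integral_rclike_tendsto ℂ).1 hσ (invOneAddBCF hs)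
    have h2 := hcc.mul (h1.const_sub 1)
    rw [mul_sub] at h2 ⊢
    refine (h2.congr fun j => ?_)
    have h3 := card_mul_integral_ncm (τ j) (invOneAddBCF hs)
    rw [Complex.real_smul] at h3
    have h4 : ∑ α, (1 + (τ j α : ℂ) * s)⁻¹ = ∑ α, invOneAddBCF hs (τ j α) := rfl
    rw [Finset.sum_sub_distrib, mul_sub, mul_sub, h4, ← h3]
    push_cast
    simp only [Finset.sum_const, Finset.card_univ, nsmul_eq_mul]
    ring
  have hbound : Tendsto (fun j => (Fintype.card (A j) : ℝ) / Fintype.card (I j) *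
        (‖s - w j‖ * ((w j).im⁻¹ * (‖s‖ / s.im)))
      + (numClipped (T j) (τ j) : ℝ) / Fintype.card (I j) * (2 * (‖s‖ / s.im))) atTop (𝓝 0) := by
    have h1 : Tendsto (fun j => ‖s - w j‖) atTop (𝓝 0) := by
      simpa using (hw.const_sub s).norm
    have h2 := hc.mul (h1.mul ((him.inv₀ hs.ne').mul_const (‖s‖ / s.im)))
    have h3 := (tendsto_numClipped_div (fun j => Nat.cast_nonneg _) hc hσ hT).mul_const
      (2 * (‖s‖ / s.im))
    simpa using h2.add h3
  rw [← sub_zero ((c : ℂ) * _)]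
  have hdiff : Tendsto (fun j => (Fintype.card (I j) : ℂ)⁻¹ * ∑ α,
      ((1 + (clip (T j) (τ j α) : ℂ) * w j)⁻¹ - (1 + (τ j α : ℂ) * s)⁻¹)) atTop (𝓝 0) := by
    refine squeeze_zero_norm (fun j => ?_) hbound
    rw [norm_mul, norm_inv, Complex.norm_natCast, inv_mul_eq_div, div_mul_eq_mul_div,
      div_mul_eq_mul_div, ← add_div]
    refine div_le_div_of_nonneg_right ((norm_sum_le _ _).trans ?_) (Nat.cast_nonneg _)
    have hterm : ∀ α, ‖(1 + (clip (T j) (τ j α) : ℂ) * w j)⁻¹ - (1 + (τ j α : ℂ) * s)⁻¹‖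
        ≤ ‖s - w j‖ * ((w j).im⁻¹ * (‖s‖ / s.im))
          + if τ j α ≠ clip (T j) (τ j α) then 2 * (‖s‖ / s.im) else 0 := fun α => by
      refine (norm_sub_le_norm_sub_add_norm_sub _ (1 + (clip (T j) (τ j α) : ℂ) * s)⁻¹ _).trans
        (add_le_add (norm_inv_one_add_sub_le _ (hw0 j) hs) ?_)
      split_ifs with h
      · refine (norm_sub_le _ _).trans ?_
        have h1 := norm_inv_one_add_le (clip (T j) (τ j α)) hs
        have h2 := norm_inv_one_add_le (τ j α) hs
        linarith
      · rw [not_not] at h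
        rw [← h, sub_self, norm_zero]
    refine (Finset.sum_le_sum fun α _ => hterm α).trans_eq ?_
    rw [Finset.sum_add_distrib, ← Finset.sum_filter, Finset.sum_const, Finset.sum_const]
    simp [numClipped]
  refine (hmain.sub hdiff).congr fun j => ?_
  rw [← mul_sub, ← Finset.sum_sub_distrib]
  congr 1
  refine Finset.sum_congr rfl fun α _ => ?_
  ring

/-- The prefactor `|g| / Im g` of the error needs no a priori bound: `g` converges to the Stieltjes
transform of a probability measure, whose imaginary part is positive. -/
lemma equation_of_tendsto
    (hc : Tendsto (fun j => (Fintype.card (A j) : ℝ) / Fintype.card (I j)) atTop (𝓝 c))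
    (hσ : Tendsto (fun j => normalizedCountingMeasure (τ j)) atTop (𝓝 σ.toFiniteMeasure))
    {T s : ℕ → ℝ} (hT0 : ∀ j, 0 ≤ T j) (hs0 : ∀ j, 0 < s j) (hT : Tendsto T atTop atTop)
    {N : ProbabilityMeasure ℝ}
    (hN : Tendsto (fun j => spectralMeasure (τ j) (Y j)) atTop (𝓝 N)) {z : ℂ} (hz : 0 < z.im)
    (herr : Tendsto (fun j => equationError (fun α => clip (T j) (τ j α)) (Y j) z (T j) (s j))
      atTop (𝓝 0)) :
    z * stieltjesTransform N z
      = c - 1 - c * ∫ t : ℝ, (1 + (t : ℂ) * stieltjesTransform N z)⁻¹ ∂(σ : Measure ℝ) := by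
  have hspos := im_stieltjesTransform_pos N hz
  have h1 := tendsto_stieltjesTransform hN hz.ne'
  simp only [fun j => stieltjesTransform_spectralMeasure (τ j) (Y j) hz] at h1
  set s₀ := stieltjesTransform N z
  have h2 : Tendsto (fun j => gramTrace (τ j) (Y j) z
      - gramTrace (fun α => clip (T j) (τ j α)) (Y j) z) atTop (𝓝 0) := by
    refine squeeze_zero_norm (fun j => norm_gramTrace_sub_clip_le (T j) (τ j) (Y j) hz) ?_
    simpa using (tendsto_numClipped_div (fun j => Nat.cast_nonneg _) hc hσ hT).mul_const z.im⁻¹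
  have h3 : Tendsto (fun j => gramTrace (fun α => clip (T j) (τ j α)) (Y j) z) atTop (𝓝 s₀) := by
    simpa using h1.sub h2
  have h4 : Tendsto (fun j => ‖gramTrace (fun α => clip (T j) (τ j α)) (Y j) z‖ /
      (gramTrace (fun α => clip (T j) (τ j α)) (Y j) z).im *
      equationError (fun α => clip (T j) (τ j α)) (Y j) z (T j) (s j)) atTop (𝓝 0) := by
    simpa using (h3.norm.div ((Complex.continuous_im.tendsto s₀).comp h3) hspos.ne').mul herr
  have h5 := squeeze_zero_norm (fun j => norm_approx_equation_le (fun α => clip (T j) (τ j α)) (Y j)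
    hz (gramTrace_im_pos _ _ hz) (hs0 j) (fun α => abs_clip_le (hT0 j) _)) h4
  have h6 := tendsto_sum_inv_one_add hc hσ hT hspos
    (fun j => gramTrace_im_pos (fun α => clip (T j) (τ j α)) (Y j) hz) h3
  have h7 := tendsto_nhds_unique h5 (((h3.const_mul z).const_add 1).sub h6)
  linear_combination -h7

/-- Extraction of a weakly convergent subsequence of spectral measures, whose limit solves the
functional equation. -/
theorem exists_subseq_tendsto_spectralMeasure
    (hc : Tendsto (fun j => (Fintype.card (A j) : ℝ) / Fintype.card (I j)) atTop (𝓝 c))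
    (hσ : Tendsto (fun j => normalizedCountingMeasure (τ j)) atTop (𝓝 σ.toFiniteMeasure))
    {T s : ℕ → ℝ} (hT0 : ∀ j, 0 ≤ T j) (hs0 : ∀ j, 0 < s j) (hT : Tendsto T atTop atTop)
    {K : ℝ} (hK : ∀ᶠ j in atTop, (Fintype.card (I j) : ℝ)⁻¹ * ∑ α, ∑ i, Y j α i ^ 2 ≤ K)
    {d : ℕ → {z : ℂ // 0 < z.im}} (hd : DenseRange d)
    (herr : ∀ q, Tendsto (fun j => equationError (fun α => clip (T j) (τ j α)) (Y j) (d q)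
      (T j) (s j)) atTop (𝓝 0)) :
    ∃ (N : ProbabilityMeasure ℝ) (φ : ℕ → ℕ), StrictMono φ ∧
      Tendsto (fun j => spectralMeasure (τ (φ j)) (Y (φ j))) atTop (𝓝 N) ∧
      ∀ z : ℂ, 0 < z.im → z * stieltjesTransform N z
        = c - 1 - c * ∫ t : ℝ, (1 + (t : ℂ) * stieltjesTransform N z)⁻¹ ∂(σ : Measure ℝ) := by
  have htight := isTightMeasureSet_spectralMeasure hc hσ hK
  have hcomp := isCompact_closure_of_isTightMeasureSet
    (S := Set.range fun j => spectralMeasure (τ j) (Y j)) (by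
      convert htight using 1
      ext μ
      simp)
  obtain ⟨N, -, φ, hφ, hN⟩ := hcomp.tendsto_subseq
    (fun j => subset_closure (Set.mem_range_self (f := fun j => spectralMeasure (τ j) (Y j)) j))
  refine ⟨N, φ, hφ, hN, ?_⟩
  have hcontS : Continuous fun z : {z : ℂ // 0 < z.im} => stieltjesTransform N z :=
    continuous_iff_continuousAt.2 fun z =>
      ((analyticOnNhd_stieltjesTransform N z z.2.ne').continuousAt).comp
        continuous_subtype_val.continuousAt
  have hcontI : Continuous fun z : {z : ℂ // 0 < z.im} =>
      ∫ t : ℝ, (1 + (t : ℂ) * stieltjesTransform N z)⁻¹ ∂(σ : Measure ℝ) :=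
    continuous_iff_continuousAt.2 fun z =>
      tendsto_integral_inv_one_add σ (im_stieltjesTransform_pos N z.2) (hcontS.tendsto z)
  -- The equation is known on a countable dense set and both sides are continuous in `z`.
  have heq := hd.equalizer (g := fun z : {z : ℂ // 0 < z.im} => (z : ℂ) * stieltjesTransform N z)
    (h := fun z => c - 1 - c * ∫ t : ℝ, (1 + (t : ℂ) * stieltjesTransform N z)⁻¹ ∂(σ : Measure ℝ))
    (continuous_subtype_val.mul hcontS) (continuous_const.sub (continuous_const.mul hcontI))
    (funext fun q => equation_of_tendsto (τ := fun j => τ (φ j)) (Y := fun j => Y (φ j))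
      (hc.comp hφ.tendsto_atTop) (hσ.comp hφ.tendsto_atTop) (T := fun j => T (φ j))
      (s := fun j => s (φ j)) (fun j => hT0 _)
      (fun j => hs0 _) (hT.comp hφ.tendsto_atTop) hN (d q).2 ((herr q).comp hφ.tendsto_atTop))
  exact fun z hz => congrFun heq ⟨z, hz⟩

end Convergence

end Limit
end

noncomputable section

/-! ### Expected errors under the product law -/

section Expectation

open Matrix

/-- Resampling one coordinate independently preserves the product law. With Fubini this lets `Y α`
be integrated while the other vectors are frozen. -/
lemma map_update_pi {ι X : Type*} [Fintype ι] [DecidableEq ι] [MeasurableSpace X] (μ : Measure X)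
    [IsProbabilityMeasure μ] (α : ι) :
    ((Measure.pi fun _ : ι => μ).prod μ).map (fun p => Function.update p.1 α p.2)
      = Measure.pi fun _ : ι => μ := by
  have hm : Measurable fun p : (ι → X) × X => Function.update p.1 α p.2 := by
    refine measurable_pi_iff.2 fun i => ?_
    by_cases h : i = α
    · subst h; simpa using measurable_snd
    · simp only [Function.update_of_ne h]; fun_prop
  refine (Measure.pi_eq fun s hs => ?_).symm
  rw [Measure.map_apply hm (MeasurableSet.univ_pi hs)]
  have e : (fun p : (ι → X) × X => Function.update p.1 α p.2) ⁻¹' Set.univ.pi s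
      = (Set.univ.pi (Function.update s α Set.univ)) ×ˢ s α := by
    ext p
    simp only [Set.mem_preimage, Set.mem_univ_pi, Set.mem_prod]
    constructor
    · intro h
      refine ⟨fun i => ?_, by simpa using h α⟩
      by_cases hi : i = α
      · subst hi; simp
      · simpa [hi] using h i
    · rintro ⟨h1, h2⟩ i
      by_cases hi : i = α
      · subst hi; simpa using h2
      · simpa [hi] using h1 i
  rw [e, Measure.prod_prod, Measure.pi_pi, ← Finset.mul_prod_erase _ _ (Finset.mem_univ α),
    ← Finset.mul_prod_erase _ (fun i => μ (s i)) (Finset.mem_univ α)]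
  rw [Finset.prod_congr rfl fun i hi => by rw [Function.update_of_ne (Finset.ne_of_mem_erase hi)]]
  simp [mul_comm]

lemma lintegral_pi_update {ι X : Type*} [Fintype ι] [DecidableEq ι] [MeasurableSpace X]
    (μ : Measure X) [IsProbabilityMeasure μ] (α : ι) {f : (ι → X) → ℝ≥0∞} (hf : Measurable f) :
    ∫⁻ y, f y ∂(Measure.pi fun _ : ι => μ)
      = ∫⁻ y, ∫⁻ v, f (Function.update y α v) ∂μ ∂(Measure.pi fun _ : ι => μ) := by
  have hm : Measurable fun p : (ι → X) × X => Function.update p.1 α p.2 := by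
    refine measurable_pi_iff.2 fun i => ?_
    by_cases h : i = α
    · subst h; simpa using measurable_snd
    · simp only [Function.update_of_ne h]; fun_prop
  conv_lhs => rw [← map_update_pi μ α]
  rw [lintegral_map hf hm]
  exact lintegral_prod _ (hf.comp hm).aemeasurable

/-- Cramer's formula; measurability, unlike continuity, survives points where the determinant
vanishes. -/
lemma measurable_inv_apply {X I : Type*} [TopologicalSpace X] [MeasurableSpace X]
    [OpensMeasurableSpace X] [Fintype I] [DecidableEq I] {M : X → Matrix I I ℂ}
    (hM : Continuous M) (i j : I) : Measurable fun x => (M x)⁻¹ i j := by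
  simp only [Matrix.inv_def, Matrix.smul_apply, Ring.inverse_eq_inv', smul_eq_mul]
  exact hM.matrix_det.measurable.inv.mul (hM.matrix_adjugate.matrix_elem i j).measurable

variable {n m k : ℕ}

/-- The vectors `Y α` of the model. -/
abbrev tensorFamily (y : Fin m → Fin k → Fin n → ℝ) : Fin m → (Fin k → Fin n) → ℝ :=
  fun α => tensorVector (y α)

lemma continuous_tensorFamily_apply (α : Fin m) (a : Fin k → Fin n) :
    Continuous fun y : Fin m → Fin k → Fin n → ℝ => tensorFamily y α a :=
  (continuous_tensorVector a).comp (continuous_apply α)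

lemma continuous_shifted_tensorFamily (τ : Fin m → ℝ) (z : ℂ) :
    Continuous fun y : Fin m → Fin k → Fin n → ℝ =>
      shifted (weightedGram τ (tensorFamily y)) z := by
  refine continuous_pi fun a => continuous_pi fun b => ?_
  have := continuous_tensorFamily_apply (n := n) (m := m) (k := k)
  simp only [shifted, weightedGram, Matrix.sub_apply, Matrix.map_apply, Matrix.sum_apply,
    Matrix.smul_apply, vecMulVec_apply]
  fun_prop

lemma measurable_quadDeviation (τ : Fin m → ℝ) (z : ℂ) (α : Fin m) :
    Measurable fun y : Fin m → Fin k → Fin n → ℝ => quadDeviation τ (tensorFamily y) z α := by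
  have h1 := fun a b => measurable_inv_apply
    (continuous_shifted_tensorFamily (n := n) (k := k) (Function.update τ α 0) z) a b
  have h2 : ∀ a, Measurable fun y : Fin m → Fin k → Fin n → ℝ => cvec (tensorFamily y α) a :=
    fun a => Complex.measurable_ofReal.comp
      (continuous_tensorFamily_apply (n := n) (k := k) α a).measurable
  have h3 : Measurable fun y : Fin m → Fin k → Fin n → ℝ => cvec (tensorFamily y α) ⬝ᵥ
      minorResolvent τ (tensorFamily y) z α *ᵥ cvec (tensorFamily y α) :=
    Finset.measurable_fun_sum _ fun a _ => (h2 a).mul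
      (Finset.measurable_fun_sum _ fun b _ => (h1 a b).mul (h2 b))
  have h4 : Measurable fun y : Fin m → Fin k → Fin n → ℝ =>
      (minorResolvent τ (tensorFamily y) z α).trace :=
    Finset.measurable_fun_sum _ fun a _ => h1 a a
  exact (h3.sub (h4.div_const _)).norm.pow_const 2

lemma card_fun_fin : ((Fintype.card (Fin k → Fin n) : ℕ) : ℂ) = (n : ℂ) ^ k := by simp

/-- After resampling `y α`, the reduced resolvent is a fixed matrix of norm at most `(Im z)⁻¹`. -/
lemma lintegral_quadDeviation_le (hn : 0 < n) {ν : Measure (Fin n → ℝ)} [IsProbabilityMeasure ν]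
    {δ : ℝ} (hδ0 : 0 ≤ δ) (hδ : δ ≤ 1) (hν : HasQuadVariance ν δ) (τ : Fin m → ℝ) {z : ℂ}
    (hz : 0 < z.im) (α : Fin m) :
    ∫⁻ y, ENNReal.ofReal (quadDeviation τ (tensorFamily y) z α)
        ∂(Measure.pi fun _ : Fin m => Measure.pi fun _ : Fin k => ν)
      ≤ ENNReal.ofReal (tensorVarianceConst k * (z.im⁻¹ ^ 2 * δ)) := by
  rw [lintegral_pi_update _ α (measurable_quadDeviation τ z α).ennreal_ofReal]
  refine (lintegral_mono (g := fun _ => ENNReal.ofReal (tensorVarianceConst k * (z.im⁻¹ ^ 2 * δ)))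
    fun y => ?_).trans_eq (by simp)
  have hfam : ∀ v, tensorFamily (Function.update y α v)
      = Function.update (tensorFamily y) α (tensorVector v) := fun v => by
    ext β : 1
    by_cases h : β = α
    · subst h; simp [tensorFamily]
    · simp [tensorFamily, h]
  have hmin : ∀ v, minorResolvent τ (tensorFamily (Function.update y α v)) z α
      = minorResolvent τ (tensorFamily y) z α := fun v => by
    rw [hfam, minorResolvent, gramResolvent, weightedGram_update_zero_update]; rfl
  simp only [quadDeviation, hmin, card_fun_fin]
  simp only [tensorFamily, Function.update_self]
  exact hν.lintegral_tensor hn hδ0 hδ k _ (inv_nonneg.2 hz.le)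
    (bilinBound_inv_shifted (weightedGram_isHermitian _ _) hz)

/-- The combination of second moments which controls all the random errors. -/
def momentError (τ : Fin m → ℝ) (y : Fin m → Fin k → Fin n → ℝ) (z : ℂ) (t : ℝ) : ℝ :=
  (Fintype.card (Fin k → Fin n) : ℝ)⁻¹ * ∑ α,
    (t⁻¹ ^ 5 * quadDeviation τ (tensorFamily y) z α
      + t * (∑ a, tensorFamily y α a ^ 2) ^ 2 + t⁻¹ ^ 4 * (∑ a, tensorFamily y α a ^ 2 - 1) ^ 2)

lemma measurable_momentError (τ : Fin m → ℝ) (z : ℂ) (t : ℝ) :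
    Measurable fun y : Fin m → Fin k → Fin n → ℝ => momentError τ y z t := by
  have h1 := fun α => measurable_quadDeviation (n := n) (k := k) τ z α
  have h2 := fun α a => (continuous_tensorFamily_apply (n := n) (m := m) (k := k) α a).measurable
  unfold momentError
  fun_prop

lemma quadDeviation_nonneg {I A : Type*} [Fintype I] [DecidableEq I] [Fintype A] [DecidableEq A]
    (τ : A → ℝ) (Y : A → I → ℝ) (z : ℂ) (α : A) : 0 ≤ quadDeviation τ Y z α := sq_nonneg _

/-- The weights are balanced for variance scale `t ^ 8`: `t⁻⁵ t⁸ = t³`, `t⁻⁴ t⁸ = t⁴`, and the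
fourth moment, bounded by `4ᵏ`, carries a factor `t`. -/
lemma lintegral_momentError_le (hn : 0 < n) {ν : Measure (Fin n → ℝ)} [IsProbabilityMeasure ν]
    {t : ℝ} (ht0 : 0 < t) (ht : t ≤ 1) (hν : HasQuadVariance ν (t ^ 8)) (τ : Fin m → ℝ) {z : ℂ}
    (hz : 0 < z.im) :
    ∫⁻ y, ENNReal.ofReal (momentError τ y z t)
        ∂(Measure.pi fun _ : Fin m => Measure.pi fun _ : Fin k => ν)
      ≤ ENNReal.ofReal ((m : ℝ) / (n : ℝ) ^ k * (tensorVarianceConst k * z.im⁻¹ ^ 2 * t ^ 3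
        + 4 ^ k * t + tensorVarianceConst k * t ^ 4)) := by
  have hδ0 : 0 ≤ t ^ 8 := by positivity
  have hδ1 : t ^ 8 ≤ 1 := pow_le_one₀ ht0.le ht
  have hC := tensorVarianceConst_nonneg k
  set μ := Measure.pi fun _ : Fin m => Measure.pi fun _ : Fin k => ν with hμ
  have hQm := fun α => measurable_quadDeviation (n := n) (k := k) τ z α
  have hSm : ∀ α : Fin m, Measurable fun y : Fin m → Fin k → Fin n → ℝ =>
      ∑ a, tensorFamily y α a ^ 2 := fun α => by
    have h2 := fun a => (continuous_tensorFamily_apply (n := n) (m := m) (k := k) α a).measurable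
    fun_prop
  have hev : ∀ (α : Fin m) {f : (Fin k → Fin n → ℝ) → ℝ≥0∞}, Measurable f →
      ∫⁻ y, f (y α) ∂μ = ∫⁻ v, f v ∂(Measure.pi fun _ : Fin k => ν) := fun α f hf =>
    (measurePreserving_eval (fun _ : Fin m => Measure.pi fun _ : Fin k => ν) α).lintegral_comp hf
  have hTm : Measurable fun v : Fin k → Fin n → ℝ => ∑ a, tensorVector v a ^ 2 := by
    have := fun a => (continuous_tensorVector (n := n) (k := k) a).measurable
    fun_prop
  have h4 : ∀ α, ∫⁻ y, ENNReal.ofReal ((∑ a, tensorFamily y α a ^ 2) ^ 2) ∂μ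
      ≤ ENNReal.ofReal (4 ^ k) := fun α => by
    refine (hev α (f := fun v => ENNReal.ofReal ((∑ a, tensorVector v a ^ 2) ^ 2))
      (hTm.pow_const 2).ennreal_ofReal).trans_le ?_
    exact hν.lintegral_tensor_norm_pow_four hn hδ1 k
  have h2 : ∀ α, ∫⁻ y, ENNReal.ofReal ((∑ a, tensorFamily y α a ^ 2 - 1) ^ 2) ∂μ
      ≤ ENNReal.ofReal (tensorVarianceConst k * t ^ 8) := fun α => by
    refine (hev α (f := fun v => ENNReal.ofReal ((∑ a, tensorVector v a ^ 2 - 1) ^ 2))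
      ((hTm.sub_const 1).pow_const 2).ennreal_ofReal).trans_le ?_
    have h := hν.lintegral_tensor hn hδ0 hδ1 k 1 zero_le_one bilinBound_one
    have hn' : (n : ℂ) ^ k ≠ 0 := pow_ne_zero _ (by exact_mod_cast hn.ne')
    simp only [one_mulVec, cvec_dotProduct_self, trace_one, card_fun_fin, div_self hn', one_pow,
      one_mul] at h
    convert h using 4 with y
    rw [← Complex.ofReal_one, ← Complex.ofReal_sub, Complex.norm_real, Real.norm_eq_abs, sq_abs]
  have hterm : ∀ α, ∫⁻ y, ENNReal.ofReal (t⁻¹ ^ 5 * quadDeviation τ (tensorFamily y) z α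
      + t * (∑ a, tensorFamily y α a ^ 2) ^ 2
      + t⁻¹ ^ 4 * (∑ a, tensorFamily y α a ^ 2 - 1) ^ 2) ∂μ
      ≤ ENNReal.ofReal (tensorVarianceConst k * z.im⁻¹ ^ 2 * t ^ 3
        + 4 ^ k * t + tensorVarianceConst k * t ^ 4) := fun α => by
    have hq := fun y : Fin m → Fin k → Fin n → ℝ => quadDeviation_nonneg τ (tensorFamily y) z α
    calc _ = ∫⁻ y, (ENNReal.ofReal (t⁻¹ ^ 5) * ENNReal.ofReal (quadDeviation τ (tensorFamily y) z α)
          + ENNReal.ofReal t * ENNReal.ofReal ((∑ a, tensorFamily y α a ^ 2) ^ 2)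
          + ENNReal.ofReal (t⁻¹ ^ 4)
            * ENNReal.ofReal ((∑ a, tensorFamily y α a ^ 2 - 1) ^ 2)) ∂μ := by
          refine lintegral_congr fun y => ?_
          have := hq y
          rw [ENNReal.ofReal_add (by positivity) (by positivity),
            ENNReal.ofReal_add (by positivity) (by positivity),
            ENNReal.ofReal_mul (by positivity), ENNReal.ofReal_mul (by positivity),
            ENNReal.ofReal_mul (by positivity)]
      _ = ENNReal.ofReal (t⁻¹ ^ 5) * ∫⁻ y, ENNReal.ofReal (quadDeviation τ (tensorFamily y) z α) ∂μ
          + ENNReal.ofReal t * ∫⁻ y, ENNReal.ofReal ((∑ a, tensorFamily y α a ^ 2) ^ 2) ∂μ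
          + ENNReal.ofReal (t⁻¹ ^ 4)
            * ∫⁻ y, ENNReal.ofReal ((∑ a, tensorFamily y α a ^ 2 - 1) ^ 2) ∂μ := by
          rw [lintegral_add_right _
              ((((hSm α).sub_const 1).pow_const 2).ennreal_ofReal.const_mul _),
            lintegral_add_right _ (((hSm α).pow_const 2).ennreal_ofReal.const_mul _),
            lintegral_const_mul' _ _ ENNReal.ofReal_ne_top,
            lintegral_const_mul' _ _ ENNReal.ofReal_ne_top,
            lintegral_const_mul' _ _ ENNReal.ofReal_ne_top]
      _ ≤ ENNReal.ofReal (t⁻¹ ^ 5) * ENNReal.ofReal (tensorVarianceConst k * (z.im⁻¹ ^ 2 * t ^ 8))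
          + ENNReal.ofReal t * ENNReal.ofReal (4 ^ k)
          + ENNReal.ofReal (t⁻¹ ^ 4) * ENNReal.ofReal (tensorVarianceConst k * t ^ 8) := by
          gcongr
          · exact lintegral_quadDeviation_le hn hδ0 hδ1 hν τ hz α
          · exact h4 α
          · exact h2 α
      _ = _ := by
          rw [← ENNReal.ofReal_mul (by positivity), ← ENNReal.ofReal_mul (by positivity),
            ← ENNReal.ofReal_mul (by positivity), ← ENNReal.ofReal_add (by positivity)
            (by positivity), ← ENNReal.ofReal_add (by positivity) (by positivity)]
          congr 1
          field_simp
  have hcard : (Fintype.card (Fin k → Fin n) : ℝ) = (n : ℝ) ^ k := by simp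
  have hpos : ∀ (y : Fin m → Fin k → Fin n → ℝ) (α : Fin m),
      0 ≤ t⁻¹ ^ 5 * quadDeviation τ (tensorFamily y) z α
      + t * (∑ a, tensorFamily y α a ^ 2) ^ 2
      + t⁻¹ ^ 4 * (∑ a, tensorFamily y α a ^ 2 - 1) ^ 2 := fun y α => by
    have := quadDeviation_nonneg τ (tensorFamily y) z α
    positivity
  calc ∫⁻ y, ENNReal.ofReal (momentError τ y z t) ∂μ
      = ENNReal.ofReal (((n : ℝ) ^ k)⁻¹) * ∑ α, ∫⁻ y, ENNReal.ofReal
        (t⁻¹ ^ 5 * quadDeviation τ (tensorFamily y) z α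
          + t * (∑ a, tensorFamily y α a ^ 2) ^ 2
          + t⁻¹ ^ 4 * (∑ a, tensorFamily y α a ^ 2 - 1) ^ 2) ∂μ := by
        rw [← lintegral_finsetSum' _ fun α _ => ?_,
          ← lintegral_const_mul' _ _ ENNReal.ofReal_ne_top]
        · refine lintegral_congr fun y => ?_
          rw [momentError, hcard, ENNReal.ofReal_mul (by positivity),
            ENNReal.ofReal_sum_of_nonneg fun α _ => hpos y α]
        · exact ((((hQm α).const_mul _).add (((hSm α).pow_const 2).const_mul _)).add
            ((((hSm α).sub_const 1).pow_const 2).const_mul _)).ennreal_ofReal.aemeasurable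
    _ ≤ ENNReal.ofReal (((n : ℝ) ^ k)⁻¹) * ∑ _ : Fin m,
          ENNReal.ofReal (tensorVarianceConst k * z.im⁻¹ ^ 2 * t ^ 3
          + 4 ^ k * t + tensorVarianceConst k * t ^ 4) := by
        gcongr with α _
        exact hterm α
    _ = _ := by
        rw [Finset.sum_const, Finset.card_univ, Fintype.card_fin, nsmul_eq_mul,
          ← ENNReal.ofReal_natCast, ← ENNReal.ofReal_mul (by positivity),
          ← ENNReal.ofReal_mul (by positivity)]
        congr 1
        ring

/-- Truncation level `T = t⁻¹` and AM–GM weight `s = t⁴`: then `T s⁻¹ = t⁻⁵` and `T s T² = t`, the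
first two weights in `momentError`. -/
lemma equationError_le_momentError (τ : Fin m → ℝ) (y : Fin m → Fin k → Fin n → ℝ) (z : ℂ) {t : ℝ}
    (ht0 : 0 < t) :
    equationError τ (tensorFamily y) z t⁻¹ (t ^ 4) ≤ (1 + z.im⁻¹ ^ 2) * momentError τ y z t
      + (m : ℝ) / (n : ℝ) ^ k * (t⁻¹ ^ 5 * (z.im⁻¹ / (n : ℝ) ^ k) ^ 2 + t ^ 3) := by
  have hcard : (Fintype.card (Fin k → Fin n) : ℝ) = (n : ℝ) ^ k := by simp
  have e : (1 + z.im⁻¹ ^ 2) * momentError τ y z t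
      + (m : ℝ) / (n : ℝ) ^ k * (t⁻¹ ^ 5 * (z.im⁻¹ / (n : ℝ) ^ k) ^ 2 + t ^ 3)
      = ((n : ℝ) ^ k)⁻¹ * ∑ α, ((1 + z.im⁻¹ ^ 2) *
        (t⁻¹ ^ 5 * quadDeviation τ (tensorFamily y) z α
          + t * (∑ a, tensorFamily y α a ^ 2) ^ 2
          + t⁻¹ ^ 4 * (∑ a, tensorFamily y α a ^ 2 - 1) ^ 2)
        + (t⁻¹ ^ 5 * (z.im⁻¹ / (n : ℝ) ^ k) ^ 2 + t ^ 3)) := by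
    rw [Finset.sum_add_distrib, ← Finset.mul_sum, Finset.sum_const, Finset.card_univ,
      Fintype.card_fin, nsmul_eq_mul, momentError, hcard]
    ring
  rw [e, equationError, hcard]
  gcongr with α _
  have hq := quadDeviation_nonneg τ (tensorFamily y) z α
  generalize quadDeviation τ (tensorFamily y) z α = Q at *
  generalize ∑ a, tensorFamily y α a ^ 2 = S at *
  clear e
  generalize z.im⁻¹ = e at *
  generalize e / (n : ℝ) ^ k = f
  have e1 : t⁻¹ * ((t ^ 4)⁻¹ * (Q + f ^ 2) + t ^ 4 * (1 + (t⁻¹ * e * S) ^ 2))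
      = t⁻¹ ^ 5 * Q + t⁻¹ ^ 5 * f ^ 2 + t ^ 3 + e ^ 2 * (t * S ^ 2) := by
    field_simp
    ring
  rw [e1]
  have h1 : 0 ≤ e ^ 2 * (t⁻¹ ^ 5 * Q) := by positivity
  have h2 : 0 ≤ t * S ^ 2 := by positivity
  have h3 : 0 ≤ (1 + e ^ 2) * (t⁻¹ ^ 4 * (S - 1) ^ 2) := by positivity
  linarith

/-- Completing the square gives `S - 1 ≤ t⁻⁴ (S - 1)² + t⁴ / 4`, the purpose of the third term of
`momentError`. -/
lemma sum_sq_le_momentError (τ : Fin m → ℝ) (y : Fin m → Fin k → Fin n → ℝ) (z : ℂ) {t : ℝ}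
    (ht0 : 0 < t) :
    (Fintype.card (Fin k → Fin n) : ℝ)⁻¹ * ∑ α, ∑ a, tensorFamily y α a ^ 2
      ≤ momentError τ y z t + (m : ℝ) / (n : ℝ) ^ k * (1 + t ^ 4) := by
  have hcard : (Fintype.card (Fin k → Fin n) : ℝ) = (n : ℝ) ^ k := by simp
  have e : momentError τ y z t + (m : ℝ) / (n : ℝ) ^ k * (1 + t ^ 4)
      = ((n : ℝ) ^ k)⁻¹ * ∑ α, ((t⁻¹ ^ 5 * quadDeviation τ (tensorFamily y) z α
          + t * (∑ a, tensorFamily y α a ^ 2) ^ 2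
          + t⁻¹ ^ 4 * (∑ a, tensorFamily y α a ^ 2 - 1) ^ 2) + (1 + t ^ 4)) := by
    rw [Finset.sum_add_distrib, Finset.sum_const, Finset.card_univ,
      Fintype.card_fin, nsmul_eq_mul, momentError, hcard]
    ring
  rw [e, hcard]
  gcongr with α _
  have hq := quadDeviation_nonneg τ (tensorFamily y) z α
  generalize quadDeviation τ (tensorFamily y) z α = Q at *
  generalize ∑ a, tensorFamily y α a ^ 2 = S at *
  have h1 : 0 ≤ t⁻¹ ^ 5 * Q := by positivity
  have h2 : 0 ≤ t * S ^ 2 := by positivity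
  have h3 : 0 ≤ t⁻¹ ^ 4 * ((S - 1) - t ^ 4 / 2) ^ 2 := by positivity
  have h4 : t⁻¹ ^ 4 * ((S - 1) - t ^ 4 / 2) ^ 2
      = t⁻¹ ^ 4 * (S - 1) ^ 2 - (S - 1) + t ^ 4 / 4 := by
    field_simp
    ring
  have h5 : 0 < t ^ 4 := by positivity
  linarith

end Expectation

/-! ### Extraction of sample sequences -/

section Selection

/-- By a union bound, the first `j + 1` errors exceed `1 / (j + 1)` with total probability below `ρ`
for large `n`, so they cannot cover `A n`. Choosing points this way needs no common probability
space and no almost sure convergence. -/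
lemma exists_seq_of_frequently {Ω : ℕ → Type*} [∀ n, MeasurableSpace (Ω n)]
    (P : ∀ n, Measure (Ω n)) (R : ℕ → ∀ n, Ω n → ℝ)
    (hR : ∀ q (ε : ℝ), 0 < ε → Tendsto (fun n => P n {ω | ε ≤ R q n ω}) atTop (𝓝 0))
    (A : ∀ n, Set (Ω n)) {ρ : ℝ≥0∞} (hρ : 0 < ρ) (hA : ∃ᶠ n in atTop, ρ ≤ P n (A n)) :
    ∃ φ : ℕ → ℕ, StrictMono φ ∧ ∃ ω : ∀ j, Ω (φ j), (∀ j, ω j ∈ A (φ j)) ∧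
      ∀ q j, q ≤ j → R q (φ j) (ω j) < 1 / ((j : ℝ) + 1) := by
  have key : ∀ j : ℕ, ∃ᶠ n in atTop, ∃ ω ∈ A n, ∀ q ≤ j, R q n ω < 1 / ((j : ℝ) + 1) := by
    intro j
    have hj : (0 : ℝ) < 1 / ((j : ℝ) + 1) := by positivity
    have hsum : Tendsto (fun n => ∑ q ∈ Finset.range (j + 1),
        P n {ω | 1 / ((j : ℝ) + 1) ≤ R q n ω}) atTop (𝓝 0) := by
      simpa using tendsto_finsetSum (Finset.range (j + 1)) fun q _ => hR q _ hj
    refine (hA.and_eventually (hsum.eventually_lt_const hρ)).mono fun n ⟨h1, h2⟩ => ?_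
    by_contra! hcon
    refine absurd (h1.trans (measure_mono (t := ⋃ q ∈ Finset.range (j + 1),
      {ω | 1 / ((j : ℝ) + 1) ≤ R q n ω}) fun ω hω => ?_)) (not_le.2
        ((measure_biUnion_finset_le _ _).trans_lt h2))
    obtain ⟨q, hq, hq'⟩ := hcon ω hω
    simp only [Set.mem_iUnion, Finset.mem_range]
    exact ⟨q, by omega, hq'⟩
  obtain ⟨φ, hφ, h⟩ := extraction_forall_of_frequently key
  choose ω h1 h2 using h
  exact ⟨φ, hφ, ω, h1, fun q j hqj => h2 j q hqj⟩

lemma tendsto_measure_ge_of_lintegral_le {Ω : ℕ → Type*} [∀ n, MeasurableSpace (Ω n)]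
    (P : ∀ n, Measure (Ω n)) {R : ∀ n, Ω n → ℝ} {b : ℕ → ℝ}
    (hm : ∀ n, AEMeasurable (R n) (P n))
    (h : ∀ᶠ n in atTop, ∫⁻ ω, ENNReal.ofReal (R n ω) ∂(P n) ≤ ENNReal.ofReal (b n))
    (hb : Tendsto b atTop (𝓝 0)) {ε : ℝ} (hε : 0 < ε) :
    Tendsto (fun n => P n {ω | ε ≤ R n ω}) atTop (𝓝 0) := by
  have hε' : ENNReal.ofReal ε ≠ 0 := by simpa using hε
  have hlim : Tendsto (fun n => ENNReal.ofReal (b n) / ENNReal.ofReal ε) atTop (𝓝 0) := by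
    have := ENNReal.Tendsto.div_const (ENNReal.tendsto_ofReal hb) (Or.inr hε')
    simpa using this
  refine tendsto_of_tendsto_of_tendsto_of_le_of_le' tendsto_const_nhds hlim
    (Eventually.of_forall fun _ => zero_le) ?_
  filter_upwards [h] with n hn
  have h1 := meas_ge_le_lintegral_div (hm n).ennreal_ofReal hε' ENNReal.ofReal_ne_top
  refine (measure_mono fun ω hω => ?_).trans (h1.trans (ENNReal.div_le_div_right hn _))
  exact ENNReal.ofReal_le_ofReal hω

end Selection
end

noncomputable section

/-! ### The main theorem -/

section Main

lemma HasQuadVariance.mono {n : ℕ} {ν : Measure (Fin n → ℝ)} {δ δ' : ℝ}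
    (hν : HasQuadVariance ν δ) (h : δ ≤ δ') : HasQuadVariance ν δ' := fun H r hr hH =>
  (hν H r hr hH).trans (ENNReal.ofReal_le_ofReal (by gcongr))

/-- `t = (|δ_n| + 1 / (n + 1))^(1/8)`. The second summand keeps `t` positive and lets `t ^ 8` also
dominate the deterministic error of order `n⁻ᵏ`. -/
lemma IsGoodVector.exists_scale {ν : ∀ n : ℕ, Measure (Fin n → ℝ)}
    (hνprob : ∀ n, IsProbabilityMeasure (ν n)) (hν : IsGoodVector ν) :
    ∃ t : ℕ → ℝ, (∀ n, 0 < t n) ∧ Tendsto t atTop (𝓝 0) ∧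
      (∀ n, HasQuadVariance (ν n) (t n ^ 8)) ∧ ∀ n : ℕ, 1 / ((n : ℝ) + 1) ≤ t n ^ 8 := by
  obtain ⟨δ, hδ, hvar⟩ := hν.variance_le
  have hpos : ∀ n : ℕ, 0 < |δ n| + 1 / ((n : ℝ) + 1) := fun n => by positivity
  have hpow : ∀ n : ℕ, ((|δ n| + 1 / ((n : ℝ) + 1)) ^ (((8 : ℕ) : ℝ)⁻¹)) ^ 8
      = |δ n| + 1 / ((n : ℝ) + 1) := fun n =>
    Real.rpow_inv_natCast_pow (hpos n).le (by norm_num)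
  refine ⟨fun n => (|δ n| + 1 / ((n : ℝ) + 1)) ^ (((8 : ℕ) : ℝ)⁻¹),
    fun n => Real.rpow_pos_of_pos (hpos n) _, ?_, fun n => ?_, fun n => ?_⟩
  · have h1 : Tendsto (fun n : ℕ => |δ n| + 1 / ((n : ℝ) + 1)) atTop (𝓝 0) := by
      simpa using hδ.abs.add (tendsto_one_div_add_atTop_nhds_zero_nat (𝕜 := ℝ))
    have h2 := h1.rpow_const (p := ((8 : ℕ) : ℝ)⁻¹) (Or.inr (by positivity))
    rwa [Real.zero_rpow (by positivity)] at h2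
  · have := hνprob n
    refine ((hν.isotropic n).hasQuadVariance (abs_nonneg (δ n)) fun H =>
      ⟨(hvar n H).1, (hvar n H).2.trans ?_⟩).mono ?_
    · gcongr
      exact le_abs_self _
    · rw [hpow]
      have : (0 : ℝ) < 1 / ((n : ℝ) + 1) := by positivity
      linarith
  · rw [hpow]
    linarith [abs_nonneg (δ n)]

lemma hasLaw_pi_pi {ι κ Ω X : Type*} [Fintype ι] [Fintype κ] [MeasurableSpace Ω]
    [MeasurableSpace X] {P : Measure Ω} {ν : Measure X} [IsProbabilityMeasure ν]
    {y : ι → κ → Ω → X} (hlaw : ∀ α j, HasLaw (y α j) ν P)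
    (hindep : iIndepFun (fun p : ι × κ => y p.1 p.2) P) :
    HasLaw (fun ω α j => y α j ω) (Measure.pi fun _ : ι => Measure.pi fun _ : κ => ν) P := by
  have h1 := iIndepFun.hasLaw_pi (fun p : ι × κ => hlaw p.1 p.2) hindep
  have h2 : MeasurePreserving (MeasurableEquiv.curry ι κ X) (Measure.pi fun _ : ι × κ => ν)
      (Measure.pi fun _ : ι => Measure.pi fun _ : κ => ν) := by
    refine ⟨(MeasurableEquiv.curry ι κ X).measurable, ?_⟩
    have := Measure.infinitePi_map_curry (fun (_ : ι) (_ : κ) => ν)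
    simpa only [Measure.infinitePi_eq_pi] using this
  exact h2.fun_comp_hasLaw h1

lemma momentError_nonneg {n m k : ℕ} (τ : Fin m → ℝ) (y : Fin m → Fin k → Fin n → ℝ) (z : ℂ)
    {t : ℝ} (ht : 0 < t) : 0 ≤ momentError τ y z t := by
  refine mul_nonneg (by positivity) (Finset.sum_nonneg fun α _ => ?_)
  have := quadDeviation_nonneg τ (tensorFamily y) z α
  positivity

lemma equationError_nonneg {I A : Type*} [Fintype I] [DecidableEq I] [Fintype A] [DecidableEq A]
    (τ : A → ℝ) (Y : A → I → ℝ) (z : ℂ) {T s : ℝ} (hT : 0 ≤ T) (hs : 0 ≤ s) :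
    0 ≤ equationError τ Y z T s := by
  refine mul_nonneg (by positivity) (Finset.sum_nonneg fun α _ => ?_)
  have := quadDeviation_nonneg τ Y z α
  positivity

/-- `n⁻ᵏ ≤ n⁻¹ ≤ 2 / (n + 1) ≤ 2 t⁸`, so the squared error beats `t⁻⁵`. -/
lemma scale_remainder_le {n k : ℕ} (hn : 1 ≤ n) (hk : 1 ≤ k) {t e : ℝ} (ht : 0 < t)
    (hnt : 1 / ((n : ℝ) + 1) ≤ t ^ 8) :
    t⁻¹ ^ 5 * (e / (n : ℝ) ^ k) ^ 2 + t ^ 3 ≤ 4 * e ^ 2 * t ^ 11 + t ^ 3 := by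
  have hn' : (1 : ℝ) ≤ n := by exact_mod_cast hn
  have h1 : ((n : ℝ) ^ k)⁻¹ ≤ 2 * t ^ 8 := by
    calc ((n : ℝ) ^ k)⁻¹ ≤ (n : ℝ)⁻¹ :=
          inv_anti₀ (by positivity) (le_self_pow₀ hn' (by omega))
      _ ≤ 2 * (1 / ((n : ℝ) + 1)) := by
          rw [inv_eq_one_div, mul_one_div, div_le_div_iff₀ (by positivity) (by positivity)]
          linarith
      _ ≤ 2 * t ^ 8 := by gcongr
  refine add_le_add ?_ le_rfl
  calc t⁻¹ ^ 5 * (e / (n : ℝ) ^ k) ^ 2 = t⁻¹ ^ 5 * (e ^ 2 * (((n : ℝ) ^ k)⁻¹) ^ 2) := by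
        rw [div_eq_mul_inv, mul_pow]
    _ ≤ t⁻¹ ^ 5 * (e ^ 2 * (2 * t ^ 8) ^ 2) := by gcongr
    _ = 4 * e ^ 2 * t ^ 11 := by
        field_simp
        ring

/-- Along events which are not asymptotically negligible, one can extract sample points for which
the spectral measures converge weakly to a solution of the functional equation. -/
theorem exists_seq_tendsto_eigenvalueNCM (k : ℕ) (hk : 1 ≤ k)
    (m : ℕ → ℕ) (c : ℝ) (hm : Tendsto m atTop atTop)
    (hmn : Tendsto (fun n : ℕ => (m n : ℝ) / (n : ℝ) ^ k) atTop (𝓝 c))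
    (τ : ∀ m : ℕ, Fin m → ℝ) (σ : ProbabilityMeasure ℝ)
    (hτ : Tendsto (fun m => normalizedCountingMeasure (τ m)) atTop (𝓝 σ.toFiniteMeasure))
    (ν : ∀ n : ℕ, Measure (Fin n → ℝ)) (hνprob : ∀ n, IsProbabilityMeasure (ν n))
    (hν : IsGoodVector ν) {Ω : ℕ → Type*} [∀ n, MeasurableSpace (Ω n)]
    (P : ∀ n, Measure (Ω n))
    (y : ∀ n : ℕ, Fin (m n) → Fin k → Ω n → (Fin n → ℝ))
    (hlaw : ∀ n α j, HasLaw (y n α j) (ν n) (P n))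
    (hindep : ∀ n, iIndepFun (fun p : Fin (m n) × Fin k => y n p.1 p.2) (P n))
    (B : ∀ n, Set (Ω n)) {ρ : ℝ≥0∞} (hρ : 0 < ρ) (hB : ∃ᶠ n in atTop, ρ ≤ P n (B n)) :
    ∃ (N : ProbabilityMeasure ℝ) (φ : ℕ → ℕ) (ω : ∀ j, Ω (φ j)), (∀ j, ω j ∈ B (φ j)) ∧
      (∀ f : ℝ →ᵇ ℝ, Tendsto (fun j => ∫ x, f x ∂(eigenvalueNCM (τ (m (φ j)))
        (fun α i => y (φ j) α i (ω j)) : Measure ℝ)) atTop (𝓝 (∫ x, f x ∂(N : Measure ℝ)))) ∧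
      ∀ z : ℂ, 0 < z.im → z * stieltjesTransform N z
        = c - 1 - c * ∫ t : ℝ, (1 + (t : ℂ) * stieltjesTransform N z)⁻¹ ∂(σ : Measure ℝ) := by
  obtain ⟨t, ht0, htlim, hquad, htn⟩ := hν.exists_scale hνprob
  have : Nonempty {z : ℂ // 0 < z.im} := ⟨⟨Complex.I, by simp⟩⟩
  set d := TopologicalSpace.denseSeq {z : ℂ // 0 < z.im} with hd
  set R : ℕ → ∀ n, Ω n → ℝ := fun q n ω =>
    momentError (fun α => clip (t n)⁻¹ (τ (m n) α)) (fun α i => y n α i ω) (d q) (t n) with hRdef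
  have hR : ∀ q (ε : ℝ), 0 < ε → Tendsto (fun n => P n {ω | ε ≤ R q n ω}) atTop (𝓝 0) := by
    intro q ε hε
    have hlaw' := fun n => hasLaw_pi_pi (hlaw n) (hindep n)
    have hmeas := fun n => measurable_momentError (n := n) (k := k)
      (fun α => clip (t n)⁻¹ (τ (m n) α)) (d q : ℂ) (t n)
    refine tendsto_measure_ge_of_lintegral_le P (b := fun n => (m n : ℝ) / (n : ℝ) ^ k *
      (tensorVarianceConst k * (d q : ℂ).im⁻¹ ^ 2 * t n ^ 3 + 4 ^ k * t n
        + tensorVarianceConst k * t n ^ 4))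
      (fun n => (hmeas n).comp_aemeasurable (hlaw' n).aemeasurable) ?_ ?_ hε
    · filter_upwards [eventually_ge_atTop 1, htlim.eventually_le_const one_pos] with n hn ht1
      have := hνprob n
      refine le_of_eq_of_le ((hlaw' n).lintegral_comp (hmeas n).ennreal_ofReal.aemeasurable)
        (lintegral_momentError_le hn (ht0 n) ht1 (hquad n) _ (d q).2)
    · have h1 : Tendsto (fun n => tensorVarianceConst k * (d q : ℂ).im⁻¹ ^ 2 * t n ^ 3
          + 4 ^ k * t n + tensorVarianceConst k * t n ^ 4) atTop (𝓝 0) := by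
        simpa [-inv_pow] using (((htlim.pow 3).const_mul (tensorVarianceConst k * (d q : ℂ).im⁻¹ ^ 2)).add
          (htlim.const_mul (4 ^ k))).add ((htlim.pow 4).const_mul (tensorVarianceConst k))
      simpa using hmn.mul h1
  -- Requiring `1 ≤ n` inside the event makes every selected index set nonempty.
  obtain ⟨φ, hφ, ω, hω, hRω⟩ := exists_seq_of_frequently P R hR
    (fun n => {ω | ω ∈ B n ∧ 1 ≤ n}) hρ ((hB.and_eventually (eventually_ge_atTop 1)).mono
      fun n ⟨h1, h2⟩ => by simpa [h2] using h1)
  have hφ1 : ∀ j, 1 ≤ φ j := fun j => (hω j).2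
  have hne : ∀ j, Nonempty (Fin (φ j)) := fun j => ⟨⟨0, hφ1 j⟩⟩
  have hlim := hφ.tendsto_atTop
  have hmnφ : Tendsto (fun j => (m (φ j) : ℝ) / (φ j : ℝ) ^ k) atTop (𝓝 c) := hmn.comp hlim
  have htφ : Tendsto (fun j => t (φ j)) atTop (𝓝 0) := htlim.comp hlim
  have hRlim : ∀ q, Tendsto (fun j => R q (φ j) (ω j)) atTop (𝓝 0) := fun q =>
    squeeze_zero' (Eventually.of_forall fun j => momentError_nonneg _ _ _ (ht0 _))
      ((eventually_ge_atTop q).mono fun j hj => (hRω q j hj).le)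
      tendsto_one_div_add_atTop_nhds_zero_nat
  have hcard : Tendsto (fun j => (Fintype.card (Fin (m (φ j))) : ℝ)
      / Fintype.card (Fin k → Fin (φ j))) atTop (𝓝 c) := by
    simpa using hmnφ
  -- The bounding sequence tends to `c`, so `1 + c` works eventually.
  have hK : ∀ᶠ j in atTop, (Fintype.card (Fin k → Fin (φ j)) : ℝ)⁻¹ * ∑ α, ∑ i,
      tensorFamily (fun α i => y (φ j) α i (ω j)) α i ^ 2 ≤ 1 + c * 1 := by
    have h1 : Tendsto (fun j => R 0 (φ j) (ω j) + (m (φ j) : ℝ) / (φ j : ℝ) ^ k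
        * (1 + t (φ j) ^ 4)) atTop (𝓝 (0 + c * (1 + 0 ^ 4))) :=
      (hRlim 0).add (hmnφ.mul ((htφ.pow 4).const_add 1))
    have h2 : 0 + c * (1 + 0 ^ 4) < 1 + c * 1 := by norm_num
    filter_upwards [h1.eventually_lt_const h2] with j hj
    exact (sum_sq_le_momentError _ _ _ (ht0 _)).trans hj.le
  have herr : ∀ q, Tendsto (fun j => equationError
      (fun α => clip (t (φ j))⁻¹ (τ (m (φ j)) α))
      (tensorFamily fun α i => y (φ j) α i (ω j)) (d q) (t (φ j))⁻¹ (t (φ j) ^ 4))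
      atTop (𝓝 0) := by
    intro q
    have h1 : Tendsto (fun j => (1 + (d q : ℂ).im⁻¹ ^ 2) * R q (φ j) (ω j)
        + (m (φ j) : ℝ) / (φ j : ℝ) ^ k * (4 * (d q : ℂ).im⁻¹ ^ 2 * t (φ j) ^ 11 + t (φ j) ^ 3))
        atTop (𝓝 0) := by
      simpa [-inv_pow] using ((hRlim q).const_mul (1 + (d q : ℂ).im⁻¹ ^ 2)).add
        (hmnφ.mul (((htφ.pow 11).const_mul (4 * (d q : ℂ).im⁻¹ ^ 2)).add (htφ.pow 3)))
    refine squeeze_zero (fun j => equationError_nonneg _ _ _ (inv_pos.2 (ht0 _)).le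
      (pow_pos (ht0 _) 4).le) (fun j => ?_) h1
    refine (equationError_le_momentError _ _ _ (ht0 _)).trans ?_
    exact add_le_add le_rfl (mul_le_mul_of_nonneg_left
      (scale_remainder_le (hφ1 j) hk (ht0 _) (htn _)) (by positivity))
  obtain ⟨N, ψ, hψ, hN, heq⟩ := exists_subseq_tendsto_spectralMeasure
    (I := fun j => Fin k → Fin (φ j)) (A := fun j => Fin (m (φ j)))
    (τ := fun j => τ (m (φ j))) (Y := fun j => tensorFamily fun α i => y (φ j) α i (ω j))
    hcard (hτ.comp (hm.comp hlim)) (T := fun j => (t (φ j))⁻¹) (s := fun j => t (φ j) ^ 4)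
    (fun j => (inv_pos.2 (ht0 _)).le) (fun j => pow_pos (ht0 _) 4)
    ((tendsto_inv_nhdsGT_zero).comp (tendsto_nhdsWithin_iff.2
      ⟨htφ, Eventually.of_forall fun j => ht0 _⟩))
    (K := 1 + c * 1) hK (d := d) (TopologicalSpace.denseRange_denseSeq _) herr
  refine ⟨N, fun j => φ (ψ j), fun j => ω (ψ j), fun j => (hω _).1, fun f => ?_, heq⟩
  exact ProbabilityMeasure.tendsto_iff_forall_integral_tendsto.1 hN f

end Main
end

theorem theoremt (k : ℕ) (hk : 1 ≤ k)
    -- the number `m = m(n)` of summands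
    (m : ℕ → ℕ) (c : ℝ) (hc : 0 < c)
    (hm : Tendsto m atTop atTop)
    (hmn : Tendsto (fun n : ℕ => (m n : ℝ) / (n : ℝ) ^ k) atTop (𝓝 c))
    -- for each `m` real numbers `τ_1, …, τ_m`, with weakly convergent counting measures
    (τ : ∀ m : ℕ, Fin m → ℝ) (σ : ProbabilityMeasure ℝ)
    (hτ : Tendsto (fun m => normalizedCountingMeasure (τ m)) atTop (𝓝 σ.toFiniteMeasure))
    -- the laws of a good vector
    (ν : ∀ n : ℕ, Measure (Fin n → ℝ)) (hνprob : ∀ n, IsProbabilityMeasure (ν n))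
    (hν : IsGoodVector ν)
    -- i.i.d. copies `y n α j` of it, for `α ∈ [m(n)]`, `j ∈ [k]`
    {Ω : ℕ → Type*} [∀ n, MeasurableSpace (Ω n)]
    (P : ∀ n, Measure (Ω n)) (hP : ∀ n, IsProbabilityMeasure (P n))
    (y : ∀ n : ℕ, Fin (m n) → Fin k → Ω n → (Fin n → ℝ))
    (hlaw : ∀ n α j, HasLaw (y n α j) (ν n) (P n))
    (hindep : ∀ n, iIndepFun (fun p : Fin (m n) × Fin k => y n p.1 p.2) (P n)) :
    ∃ N : ProbabilityMeasure ℝ,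
      TendstoWeaklyInProbability P
        (fun n ω => eigenvalueNCM (τ (m n)) (fun α j => y n α j ω)) N ∧
      IsMPSolution c σ (stieltjesTransform N) ∧
      ∀ g : ℂ → ℂ, IsMPSolution c σ g → ∀ z : ℂ, z.im ≠ 0 → g z = stieltjesTransform N z := by
  have main := fun (B : ∀ n, Set (Ω n)) {ρ : ℝ≥0∞} (hρ : 0 < ρ) =>
    exists_seq_tendsto_eigenvalueNCM k hk m c hm hmn τ σ hτ ν hνprob hν P y hlaw hindep B hρ
  -- The sure event yields existence of a solution that is a Stieltjes transform.
  obtain ⟨N, -, -, -, -, hN⟩ := main (fun _ => Set.univ) one_pos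
    (Frequently.of_forall fun n => by simp)
  have hsol := isMPSolution_stieltjesTransform σ N hN
  refine ⟨N, fun f ε hε => ?_, hsol, fun g hg z hz => hg.eq_of_im_ne_zero hc hsol hz⟩
  by_contra hcon
  obtain ⟨ρ, hρ, hfreq⟩ : ∃ ρ : ℝ≥0∞, 0 < ρ ∧ ∃ᶠ n in atTop, ρ ≤ P n {ω | ε ≤
      |(∫ x, f x ∂(eigenvalueNCM (τ (m n)) (fun α j => y n α j ω) : Measure ℝ))
        - ∫ x, f x ∂(N : Measure ℝ)|} := by
    rw [ENNReal.tendsto_nhds_zero] at hcon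
    push Not at hcon
    obtain ⟨ρ, hρ, h⟩ := hcon
    exact ⟨ρ, hρ, h.mono fun n hn => hn.le⟩
  obtain ⟨N', φ, ω, hω, hconv, hN'⟩ := main _ hρ hfreq
  -- Both transforms solve the equation with positive imaginary part, so they agree. The integrals
  -- along the bad points then converge to `∫ f dN`, although they stay at distance at least `ε`
  -- from it.
  have hNN : N' = N := ProbabilityMeasure.ext_of_stieltjesTransform fun z hz =>
    mpEquation_unique hc σ hz (im_stieltjesTransform_pos N' hz) (im_stieltjesTransform_pos N hz)
      (hN' z hz) (hN z hz)
  have h1 := ((hconv f).sub_const (∫ x, f x ∂(N : Measure ℝ))).abs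
  rw [hNN, sub_self, abs_zero] at h1
  obtain ⟨j, hj⟩ := (h1.eventually_lt_const hε).exists
  exact absurd (hω j) (not_le.2 hj)
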